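/- For a finite simple connected graph $G$ let $$\xi^{ac}(G)=\sum_{u\in V(G)}\frac{M(u)}{\varepsilon(u)},$$ where $M(u)$ is the product of the degrees of the neighbours of $u$ and $\varepsilon(u)=\max_{v} d(u,v)$ is the eccentricity of $u$ (for the one-vertex graph put $\xi^{ac}=0$). Let $S_n$ denote the star on $n$ vertices. A tree of diameter $4$ is called degree balanced if the degrees of any two neighbours of its (unique) central vertex differ by at most one; $TB_{n,k}$ denotes the degree balanced tree on $n$ vertices whose central vertex has degree $k$. Let $T$ be a tree on $n\ge 1$ vertices. (a) If $n\le 15$, then $\xi^{ac}(T)\le \xi^{ac}(S_n)$, with equality if and only if $T\cong S_n$. (b) If $n\ge 16$, then the tree $TB_{n,\lceil (n-1)/3\rceil}$ exists and is unique up to isomorphism, and $\xi^{ac}(T)\le \xi^{ac}\bigl(TB_{n,\lceil (n-1)/3\rceil}\bigr)$, with equality if and only if $T\cong TB_{n,\lceil (n-1)/3\rceil}$. -/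

import Mathlib

noncomputable section

namespace AugECI

open Classical in
/-- `M(u)`: the product of the degrees of all neighbours of `u`. -/
def neighborDegreeProd {V : Type*} [Fintype V] (G : SimpleGraph V) (u : V) : ℕ :=
  ∏ v ∈ G.neighborFinset u, G.degree v

/-- The augmented eccentric connectivity index `∑ u, M(u) / ε(u)`. In a finite connected graph every
eccentricity is finite, and it is positive as soon as there are at least two vertices; the
one-vertex graph gets the value `0`. -/
def augECI {V : Type*} [Fintype V] (G : SimpleGraph V) : ℝ :=
  ∑ u : V, (neighborDegreeProd G u : ℝ) / ((G.eccent u).toNat : ℝ)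

/-- The star `S_n` on the vertices `0, …, n - 1`, with centre `0`. -/
def star (n : ℕ) [NeZero n] : SimpleGraph (Fin n) :=
  SimpleGraph.starGraph (0 : Fin n)

open Classical in
/-- `G` is a degree balanced tree: a tree of diameter `4` in which the degrees of any two neighbours
of the central vertex differ by at most one. -/
def IsDegreeBalanced {V : Type*} [Fintype V] (G : SimpleGraph V) : Prop :=
  G.IsTree ∧ G.diam = 4 ∧
    ∀ u ∈ G.center, ∀ v w : V, G.Adj u v → G.Adj u w → G.degree v ≤ G.degree w + 1

open Classical in
/-- `G` is (a copy of) `TB_{n,k}`: a degree balanced tree on `n` vertices whose central vertex has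
degree `k`. -/
def IsTB {V : Type*} [Fintype V] (n k : ℕ) (G : SimpleGraph V) : Prop :=
  Fintype.card V = n ∧ IsDegreeBalanced G ∧ ∀ u ∈ G.center, G.degree u = k

end AugECI

end

noncomputable section

namespace AugECI

/-! Put $m=n-1$ and compare values of $12\xi^{ac}$. For $m\ge 2$ the star has value $12+6m^2$.
Suppose next that all vertices lie within distance two of a vertex $c$ having at least two non-leaf
neighbours, and let $D$ be the multiset of degrees of its $k$ neighbours. The centre, its neighbours
and the remaining leaves have eccentricities 2, 3, 4, and $M$ equals $\prod D$, $k$ and the parent's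
degree respectively, so the value is `weight D`, where $D$ has sum $m$ (`IsRooted.twelve_augECI`).
Trees of diameter three fall below the star by direct estimation (`IsRooted.twelve_augECI_lt_star`).
In all other trees every eccentricity is at least 3, so the value is at most $4\sum_u M(u)$.

To bound that sum, split the vertices into the two colour classes. Over one class, $\sum M$ is at
most $\prod d+\sum d(d-1)$, with $d$ running over the degrees in the other class
(`IsRooted.sum_even_le`). Each class has degree sum $m$, and the classes have $m+1$ members
together, so the larger one has small excess $\sum(d-1)$ and its product is at most about $2^{m/2}$.
The other product is at most `maxProd m`, of order $3^{m/3}$. Hence $4\sum M$ stays below the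
leading term `6 * maxProd m` of the balanced tree (`classes_bound`).

It remains to maximise `weight` over partitions of $m$. For $m\le 14$ an enumeration shows that all
of them lie below the star. For $m\ge 15$ the maximiser is `balancedParts m`, made of threes and at
most two twos: any other partition is improved by a local exchange, or is no better than the star,
which `balancedParts m` beats because `maxProd m` is at least $m^2+3$ (`improvable_of_ne`,
`weight_le_balancedParts`). Since $D$ determines the tree (`nonempty_iso_of_degrees_eq`), the
equality case follows. -/

/-! ### Multisets of degrees and their weight. -/

/-- `∑ d (d - 1)` over the parts of a multiset. -/
def pairSum (D : Multiset ℕ) : ℕ := (D.map fun d => d * (d - 1)).sum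

/-- Twelve times the index of the tree of diameter four whose central vertex has neighbours of
degrees `D`. -/
def weight (D : Multiset ℕ) : ℕ := 6 * D.prod + 4 * D.card ^ 2 + 3 * pairSum D

@[simp] lemma pairSum_zero : pairSum 0 = 0 := rfl

@[simp] lemma pairSum_cons (a : ℕ) (D : Multiset ℕ) :
    pairSum (a ::ₘ D) = a * (a - 1) + pairSum D := by simp [pairSum]

lemma one_le_prod {D : Multiset ℕ} (h : ∀ d ∈ D, 1 ≤ d) : 1 ≤ D.prod := by
  induction D using Multiset.induction with
  | empty => simp
  | cons a D ih =>
    have h1 := h a (by simp)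
    have h2 := ih fun d hd => h d (by simp [hd])
    rw [Multiset.prod_cons]; exact Nat.mul_pos h1 h2

lemma card_le_sum {D : Multiset ℕ} (h : ∀ d ∈ D, 1 ≤ d) : D.card ≤ D.sum := by
  have := Multiset.card_nsmul_le_sum h
  simpa using this

lemma exists_max_cons {D : Multiset ℕ} (h : D ≠ 0) :
    ∃ a D', D = a ::ₘ D' ∧ ∀ d ∈ D', d ≤ a := by
  induction D using Multiset.induction with
  | empty => exact absurd rfl h
  | cons a D ih =>
    by_cases hD : D = 0
    · exact ⟨a, 0, by simp [hD], by simp⟩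
    · obtain ⟨b, D', rfl, hb⟩ := ih hD
      rcases le_total a b with hab | hab
      · refine ⟨b, a ::ₘ D', Multiset.cons_swap _ _ _, ?_⟩
        intro d hd
        rcases Multiset.mem_cons.1 hd with rfl | hd
        · exact hab
        · exact hb d hd
      · refine ⟨a, b ::ₘ D', rfl, ?_⟩
        intro d hd
        rcases Multiset.mem_cons.1 hd with rfl | hd
        · exact hab
        · exact (hb d hd).trans hab

/-! ### Enumeration of the partitions of $m\le 14$. -/

/-- Checks `Q` on the product, the number of parts and `∑ d (d - 1)` of every multiset of at most
`f` positive integers bounded by `b` with sum `m`, extending accumulated values `p`, `k`, `s`. -/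
def checkParts (Q : ℕ → ℕ → ℕ → Bool) : ℕ → ℕ → ℕ → ℕ → ℕ → ℕ → Bool
  | 0, _, _, p, k, s => Q p k s
  | f + 1, b, m, p, k, s =>
    (m != 0 || Q p k s) && (List.range b).all fun i =>
      !(Nat.ble (i + 1) m) ||
        checkParts Q f (i + 1) (m - (i + 1)) (p * (i + 1)) (k + 1) (s + (i + 1) * i)

/-- Removing a largest part leaves parts bounded by it, which matches the recursion. Every part is
at least 1, so `m` steps of fuel exhaust the multiset. -/
lemma checkParts_sound (Q : ℕ → ℕ → ℕ → Bool) (f b m p k s : ℕ)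
    (h : checkParts Q f b m p k s = true) (D : Multiset ℕ) (hpos : ∀ d ∈ D, 1 ≤ d)
    (hb : ∀ d ∈ D, d ≤ b) (hs : D.sum = m) (hf : m ≤ f) :
    Q (p * D.prod) (k + D.card) (s + pairSum D) = true := by
  induction f generalizing b m p k s D with
  | zero =>
    have : D = 0 := by
      have := card_le_sum hpos
      rw [← Multiset.card_eq_zero]; omega
    subst this
    simpa [checkParts] using h
  | succ f ih =>
    simp only [checkParts, Bool.and_eq_true, List.all_eq_true, Bool.or_eq_true] at h
    by_cases hD : D = 0
    · subst hD
      have : m = 0 := by simpa using hs.symm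
      simpa [this] using h.1
    · obtain ⟨a, D', rfl, ha⟩ := exists_max_cons hD
      have ha1 := hpos a (by simp)
      obtain ⟨i, rfl⟩ : ∃ i, a = i + 1 := ⟨a - 1, by omega⟩
      have hib := hb (i + 1) (by simp)
      rw [Multiset.sum_cons] at hs
      have h2 := h.2 i (by simp; omega)
      have h3 : Nat.ble (i + 1) m = true := by rw [Nat.ble_eq]; omega
      simp only [h3, Bool.not_true, Bool.false_eq_true, false_or] at h2
      have := ih _ _ _ _ _ h2 D' (fun d hd => hpos d (by simp [hd])) ha (by omega) (by omega)
      rw [Multiset.prod_cons, Multiset.card_cons, pairSum_cons]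
      convert this using 2
      · ring
      · ring
      · rw [Nat.add_sub_cancel]; ring

/-- The range is sharp for the second test: at $m=15$ five threes already contribute $6\cdot
243=1458$, while $12+6\cdot 15^2=1362$. The value $m=0$ is exempt from the first test because the
empty product is 1. -/
lemma checkParts_small : ∀ m ∈ List.range 15, checkParts
    (fun p k s => (m == 0 || Nat.ble (p + s) (m * m)) &&
      Nat.blt (6 * p + 4 * k ^ 2 + 3 * s) (12 + 6 * m ^ 2)) m m m 1 0 0 = true := by
  decide +kernel

lemma small_bounds {m : ℕ} (hm : m ≤ 14) {D : Multiset ℕ} (hpos : ∀ d ∈ D, 1 ≤ d)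
    (hs : D.sum = m) :
    (m ≠ 0 → D.prod + pairSum D ≤ m * m) ∧ weight D < 12 + 6 * m ^ 2 := by
  have h := checkParts_sound _ _ _ _ _ _ _
    (checkParts_small m (List.mem_range.2 (by omega))) D hpos
    (fun d hd => by rw [← hs]; exact Multiset.le_sum_of_mem hd) hs le_rfl
  simp only [Bool.and_eq_true, Bool.or_eq_true, Nat.ble_eq, Nat.blt_eq, one_mul, zero_add,
    beq_iff_eq] at h
  exact ⟨fun h0 => h.1.resolve_left h0, h.2⟩

/-! ### The maximal product of a partition and its growth. -/

/-- The largest product of positive integers with sum `m`. -/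
def maxProd : ℕ → ℕ
  | 0 => 1
  | 1 => 1
  | 2 => 2
  | 3 => 3
  | 4 => 4
  | m + 5 => 3 * maxProd (m + 2)

lemma maxProd_add_three {m : ℕ} (hm : 2 ≤ m) : maxProd (m + 3) = 3 * maxProd m := by
  obtain ⟨j, rfl⟩ := Nat.exists_eq_add_of_le hm
  rw [show 2 + j + 3 = j + 5 by ring, add_comm 2 j, maxProd]

lemma maxProd_steps (m : ℕ) : maxProd m ≤ maxProd (m + 1) ∧
    2 * maxProd m ≤ maxProd (m + 2) ∧ 3 * maxProd m ≤ maxProd (m + 3) := by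
  induction m using Nat.strong_induction_on with
  | _ m ih =>
    rcases lt_or_ge m 5 with h | h
    · interval_cases m <;> decide
    · obtain ⟨j, rfl⟩ := Nat.exists_eq_add_of_le h
      have := ih (j + 2) (by omega)
      have e0 := maxProd_add_three (m := j + 2) (by omega)
      have e1 := maxProd_add_three (m := j + 3) (by omega)
      have e2 := maxProd_add_three (m := j + 4) (by omega)
      have e3 := maxProd_add_three (m := j + 5) (by omega)
      simp only [show 5 + j = j + 5 by ring, add_assoc] at *
      norm_num at *
      omega

/-- A factor $d\ge 4$ satisfies $d\le 2(d-2)$, so splitting off a two reduces to $d-2$. -/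
lemma mul_maxProd_le (d m : ℕ) : d * maxProd m ≤ maxProd (m + d) := by
  induction d using Nat.strong_induction_on with
  | _ d ih =>
    have h := maxProd_steps m
    rcases lt_or_ge d 4 with h4 | h4
    · interval_cases d
      · simp
      · simpa using h.1
      · exact h.2.1
      · exact h.2.2
    · obtain ⟨j, rfl⟩ := Nat.exists_eq_add_of_le h4
      have h1 := ih (2 + j) (by omega)
      have h2 := (maxProd_steps (m + (2 + j))).2.1
      rw [show m + (4 + j) = m + (2 + j) + 2 by ring]
      nlinarith [Nat.zero_le (j * maxProd m)]

lemma prod_le_maxProd (D : Multiset ℕ) : D.prod ≤ maxProd D.sum := by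
  induction D using Multiset.induction with
  | empty => decide
  | cons a D ih =>
    rw [Multiset.prod_cons, Multiset.sum_cons, add_comm]
    exact (Nat.mul_le_mul_left a ih).trans (mul_maxProd_le a _)

/-- Induction in steps of three, starting at fifteen. -/
lemma three_step_induction {p : ℕ → Prop} (h15 : p 15) (h16 : p 16) (h17 : p 17)
    (step : ∀ m, 15 ≤ m → p m → p (m + 3)) {m : ℕ} (hm : 15 ≤ m) : p m := by
  induction m using Nat.strong_induction_on with
  | _ m ih =>
    rcases lt_or_ge m 18 with h | h
    · interval_cases m <;> assumption
    · obtain ⟨j, rfl⟩ := Nat.exists_eq_add_of_le' (show 3 ≤ m by omega)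
      exact step j (by omega) (ih j (by omega) (by omega))

lemma sq_le_maxProd {m : ℕ} (hm : 15 ≤ m) : m ^ 2 + 3 ≤ maxProd m := by
  refine three_step_induction (p := fun m => m ^ 2 + 3 ≤ maxProd m) (by decide) (by decide)
    (by decide) (fun m hm h => ?_) hm
  rw [maxProd_add_three (by omega)]
  nlinarith

lemma two_pow_le_maxProd {m : ℕ} (hm : 15 ≤ m) : 2 ^ (m / 2) + 2 * m + 6 < maxProd m := by
  -- Because of the floor in $m/2$ the comparison advances cleanly only in steps of 6 (factor 8
  -- against 9); carrying $m$ and $m+3$ together fits this into steps of 3.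
  have key : 2 ^ (m / 2) + 2 * m + 6 < maxProd m ∧
      2 ^ ((m + 3) / 2) + 2 * (m + 3) + 6 < maxProd (m + 3) := by
    refine three_step_induction (p := fun m => 2 ^ (m / 2) + 2 * m + 6 < maxProd m ∧
      2 ^ ((m + 3) / 2) + 2 * (m + 3) + 6 < maxProd (m + 3))
      (by decide) (by decide) (by decide) (fun m hm h => ?_) hm
    refine ⟨h.2, ?_⟩
    rw [maxProd_add_three (by omega), maxProd_add_three (by omega),
      show (m + 3 + 3) / 2 = m / 2 + 3 by omega, pow_add]
    omega
  exact key.1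

lemma two_pow_le_maxProd_odd {e : ℕ} (he : 7 ≤ e) :
    2 * (2 ^ (e + 1) + 4 * e + 4) ≤ 3 * maxProd (2 * e + 1) := by
  induction e using Nat.strong_induction_on with
  | _ e ih =>
    rcases lt_or_ge e 10 with h | h
    · interval_cases e <;> decide
    · obtain ⟨j, rfl⟩ := Nat.exists_eq_add_of_le' (show 3 ≤ e by omega)
      have := ih j (by omega) (by omega)
      rw [show 2 * (j + 3) + 1 = 2 * j + 1 + 3 + 3 by ring, maxProd_add_three (by omega),
        maxProd_add_three (by omega), show j + 3 + 1 = j + 1 + 3 by ring, pow_add]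
      omega

/-- A part $d\ge 5$ costs so much product that the loss pays for the excess of $\sum d(d-1)$ over
$3m$, which is at most $(d-4)m$ when $d$ is the largest part. -/
lemma large_part_bound {m : ℕ} (hm : 15 ≤ m) :
    ∀ d, 5 ≤ d → d ≤ m → d * maxProd (m - d) + (d - 4) * m ≤ maxProd m := by
  refine three_step_induction (p := fun m => ∀ d, 5 ≤ d → d ≤ m →
    d * maxProd (m - d) + (d - 4) * m ≤ maxProd m) ?_ ?_ ?_ (fun m hm h d h5 hd => ?_) hm
  · intro d h5 hd; interval_cases d <;> decide
  · intro d h5 hd; interval_cases d <;> decide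
  · intro d h5 hd; interval_cases d <;> decide
  · rw [maxProd_add_three (by omega)]
    rcases lt_or_ge (m - d) 2 with hlt | hge
    · have h1 := sq_le_maxProd hm
      have h2 : maxProd (m + 3 - d) ≤ 4 := by
        have : m + 3 - d ≤ 4 := by omega
        interval_cases (m + 3 - d) <;> decide
      have h3 : d * maxProd (m + 3 - d) ≤ (m + 3) * 4 := Nat.mul_le_mul hd h2
      have h4 : (d - 4) * (m + 3) ≤ (m - 1) * (m + 3) := Nat.mul_le_mul_right _ (by omega)
      obtain ⟨j, rfl⟩ := Nat.exists_eq_add_of_le hm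
      have h5 : 15 + j - 1 = 14 + j := by omega
      rw [h5] at h4
      nlinarith
    · have h1 := h d h5 (by omega)
      rw [show m + 3 - d = m - d + 3 by omega, maxProd_add_three hge]
      nlinarith [Nat.zero_le ((d - 4) * m), Nat.mul_le_mul_left (d - 4) hm]

/-! ### Bounds for $\prod d+\sum d(d-1)$. -/

lemma pairSum_le {D : Multiset ℕ} {b : ℕ} (h : ∀ d ∈ D, d ≤ b) : pairSum D ≤ (b - 1) * D.sum := by
  induction D using Multiset.induction with
  | empty => simp
  | cons a D ih =>
    rw [pairSum_cons, Multiset.sum_cons, mul_add, mul_comm a]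
    have := h a (by simp)
    exact add_le_add (Nat.mul_le_mul_right _ (by omega)) (ih fun d hd => h d (by simp [hd]))

lemma prod_add_pairSum_le {D : Multiset ℕ} (hm : 15 ≤ D.sum) :
    D.prod + pairSum D ≤ maxProd D.sum + 3 * D.sum := by
  have h0 : D ≠ 0 := by rintro rfl; simp at hm
  obtain ⟨a, D', rfl, ha⟩ := exists_max_cons h0
  have hle : ∀ d ∈ a ::ₘ D', d ≤ a := fun d hd => by
    rcases Multiset.mem_cons.1 hd with rfl | hd
    exacts [le_rfl, ha d hd]
  rcases le_or_gt a 4 with h4 | h4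
  · exact add_le_add (prod_le_maxProd _) (pairSum_le fun d hd => (hle d hd).trans h4)
  · have h1 := pairSum_le hle
    have h2 := Nat.mul_le_mul_left a (prod_le_maxProd D')
    have hs : (a ::ₘ D').sum = a + D'.sum := Multiset.sum_cons _ _
    have h3 := large_part_bound hm a h4 (by omega)
    rw [show (a ::ₘ D').sum - a = D'.sum by omega] at h3
    have h5 : (a - 1) * (a ::ₘ D').sum = (a - 4) * (a ::ₘ D').sum + 3 * (a ::ₘ D').sum := by
      rw [← add_mul]; congr 1; omega
    rw [Multiset.prod_cons]
    omega

lemma sq_le_two_pow_succ (x : ℕ) : x * x ≤ 2 ^ x + 1 := by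
  induction x using Nat.strong_induction_on with
  | _ x ih =>
    rcases lt_or_ge x 5 with h | h
    · interval_cases x <;> decide
    · obtain ⟨j, rfl⟩ := Nat.exists_eq_add_of_le' (show 1 ≤ x by omega)
      have := ih j (by omega)
      rw [pow_succ]
      nlinarith

lemma mul_add_self_le_two_pow (x : ℕ) : x * x + x + 2 ≤ 2 * 2 ^ x := by
  induction x using Nat.strong_induction_on with
  | _ x ih =>
    rcases lt_or_ge x 5 with h | h
    · interval_cases x <;> decide
    · obtain ⟨j, rfl⟩ := Nat.exists_eq_add_of_le' (show 1 ≤ x by omega)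
      have := ih j (by omega)
      rw [pow_succ]
      nlinarith

/-- The product bound is $x+1\le 2^x$ for each part $x+1$. For the sum, add parts one at a time: if
the earlier excess is 0, all earlier parts are ones and $x^2\le 2^x+1$ suffices; otherwise the
factor $2^e\ge 2$ absorbs the new term $x(x+1)$. -/
lemma prod_add_pairSum_le_excess {D : Multiset ℕ} (h : ∀ d ∈ D, 1 ≤ d) :
    D.prod ≤ 2 ^ (D.sum - D.card) ∧
    D.prod + pairSum D ≤ 2 ^ (D.sum - D.card) + 2 * (D.sum - D.card) + 2 := by
  induction D using Multiset.induction with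
  | empty => simp
  | cons a D ih =>
    have ha := h a (by simp)
    have hD : ∀ d ∈ D, 1 ≤ d := fun d hd => h d (by simp [hd])
    obtain ⟨ih1, ih2⟩ := ih hD
    have hc := card_le_sum hD
    obtain ⟨x, rfl⟩ := Nat.exists_eq_add_of_le' ha
    obtain ⟨e, he⟩ := Nat.exists_eq_add_of_le hc
    rw [he, Nat.add_sub_cancel_left] at ih1 ih2
    rw [Multiset.prod_cons, Multiset.sum_cons, Multiset.card_cons, pairSum_cons,
      show x + 1 + D.sum - (D.card + 1) = e + x by omega, Nat.add_sub_cancel, pow_add]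
    have hx : x + 1 ≤ 2 ^ x := Nat.lt_two_pow_self
    refine ⟨?_, ?_⟩
    · rw [mul_comm (2 ^ e)]; exact Nat.mul_le_mul hx ih1
    · rcases Nat.eq_zero_or_pos e with h0 | h0
      · subst h0
        have hp : D.prod ≤ 1 := by simpa using ih1
        have hq : pairSum D = 0 := by
          have : ∀ d ∈ D, d = 1 := by
            intro d hd
            have hpd : D.prod = 1 := le_antisymm hp (one_le_prod hD)
            exact Nat.dvd_one.1 (hpd ▸ Multiset.dvd_prod hd)
          rw [pairSum, Multiset.sum_eq_zero]
          intro y hy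
          obtain ⟨d, hd, rfl⟩ := Multiset.mem_map.1 hy
          simp [this d hd]
        have := sq_le_two_pow_succ x
        rw [hq]
        nlinarith
      · have h2 : 2 ≤ 2 ^ e := by
          calc 2 = 2 ^ 1 := rfl
            _ ≤ 2 ^ e := Nat.pow_le_pow_right (by norm_num) h0
        have h3 := mul_add_self_le_two_pow x
        obtain ⟨t, ht⟩ := Nat.exists_eq_add_of_le hx
        have h4 : x * D.prod ≤ x * 2 ^ e := Nat.mul_le_mul_left _ ih1
        have h5 : x * x + x ≤ 2 * t + 2 * x := by omega
        rw [ht]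
        nlinarith [Nat.mul_le_mul_right t h2]

/-! ### Maximising the weight among partitions of $m\ge 15$. -/

@[simp] lemma pairSum_add (D E : Multiset ℕ) : pairSum (D + E) = pairSum D + pairSum E := by
  simp [pairSum]

@[simp] lemma pairSum_replicate (k d : ℕ) :
    pairSum (Multiset.replicate k d) = k * (d * (d - 1)) := by simp [pairSum]

@[simp] lemma pairSum_singleton (d : ℕ) : pairSum {d} = d * (d - 1) := by simp [pairSum]

lemma prod_eq_one_imp {D : Multiset ℕ} (h : D.prod = 1) : D = Multiset.replicate D.card 1 :=
  Multiset.eq_replicate_card.2 fun _ hd => Nat.dvd_one.1 (h ▸ Multiset.dvd_prod hd)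

lemma exists_replicate_add {D : Multiset ℕ} {x y : ℕ} (h : ∀ d ∈ D, d = x ∨ d = y) :
    ∃ a b, D = Multiset.replicate a x + Multiset.replicate b y := by
  induction D using Multiset.induction with
  | empty => exact ⟨0, 0, by simp⟩
  | cons d D ih =>
    obtain ⟨a, b, hab⟩ := ih fun e he => h e (by simp [he])
    rcases h d (by simp) with rfl | rfl
    · exact ⟨a + 1, b, by rw [hab, Multiset.replicate_succ, Multiset.cons_add]⟩
    · exact ⟨a, b + 1, by rw [hab, Multiset.replicate_succ, Multiset.add_cons]⟩

/-- The multiset of twos and threes with sum `m` and at most two twos. -/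
def balancedParts (m : ℕ) : Multiset ℕ :=
  Multiset.replicate ((m - 2 * (2 * m % 3)) / 3) 3 + Multiset.replicate (2 * m % 3) 2

lemma balancedParts_sum {m : ℕ} (hm : 2 ≤ m) : (balancedParts m).sum = m := by
  simp [balancedParts]; omega

lemma balancedParts_card {m : ℕ} (hm : 2 ≤ m) : (balancedParts m).card = (m + 2) / 3 := by
  simp [balancedParts]; omega

lemma balancedParts_mem {m d : ℕ} (h : d ∈ balancedParts m) : d = 2 ∨ d = 3 := by
  simp only [balancedParts, Multiset.mem_add, Multiset.mem_replicate] at h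
  tauto

lemma balancedParts_pairSum {m : ℕ} (hm : 2 ≤ m) : 2 * m ≤ pairSum (balancedParts m) + 4 := by
  simp [balancedParts]; omega

lemma balancedParts_prod {m : ℕ} (hm : 2 ≤ m) : (balancedParts m).prod = maxProd m := by
  induction m using Nat.strong_induction_on with
  | _ m ih =>
    rcases lt_or_ge m 5 with h | h
    · interval_cases m <;> simp [balancedParts, maxProd]
    · obtain ⟨j, rfl⟩ := Nat.exists_eq_add_of_le' (show 3 ≤ m by omega)
      rw [maxProd_add_three (by omega), ← ih j (by omega) (by omega), balancedParts, balancedParts,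
        show 2 * (j + 3) % 3 = 2 * j % 3 by omega,
        show (j + 3 - 2 * (2 * j % 3)) / 3 = (j - 2 * (2 * j % 3)) / 3 + 1 by omega]
      simp only [Multiset.prod_add, Multiset.prod_replicate, pow_succ]
      ring

lemma eq_balancedParts {a b m : ℕ} (hb : b ≤ 2) (hs : 3 * a + 2 * b = m) :
    Multiset.replicate a 3 + Multiset.replicate b 2 = balancedParts m := by
  rw [balancedParts]
  congr 2 <;> omega

/-- With $k=\lceil m/3\rceil$ parts, $2k<m\le 3k$. So some part is at least 3, which forces all
parts to be at least 2; a part above 3 would force all others to be at least 3 and the sum to exceed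
$m$. -/
lemma eq_balancedParts_of_balanced {D : Multiset ℕ} {m : ℕ} (hm : 15 ≤ m) (hs : D.sum = m)
    (hc : D.card = (m + 2) / 3) (hbal : ∀ a ∈ D, ∀ b ∈ D, a ≤ b + 1) : D = balancedParts m := by
  have h3 : ∃ a ∈ D, 3 ≤ a := by
    by_contra! h
    have := Multiset.sum_le_card_nsmul D 2 fun a ha => by have := h a ha; omega
    simp only [smul_eq_mul] at this
    omega
  obtain ⟨a, haD, ha⟩ := h3
  have h2 : ∀ b ∈ D, 2 ≤ b := fun b hb => by have := hbal a haD b hb; omega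
  have h4 : ∀ b ∈ D, b ≤ 3 := by
    by_contra! h
    obtain ⟨b, hb, hb4⟩ := h
    obtain ⟨S, rfl⟩ := Multiset.exists_cons_of_mem hb
    have := Multiset.card_nsmul_le_sum (s := S) (a := 3) fun c hc => by
      have := hbal b hb c (by simp [hc]); omega
    simp only [smul_eq_mul, Multiset.card_cons, Multiset.sum_cons] at this hs hc
    omega
  obtain ⟨x, y, rfl⟩ := exists_replicate_add (D := D) (x := 3) (y := 2) fun d hd => by
    have := h2 d hd; have := h4 d hd; omega
  simp only [Multiset.sum_add, Multiset.sum_replicate, Multiset.card_add,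
    Multiset.card_replicate, smul_eq_mul] at hs hc
  exact eq_balancedParts (by omega) (by omega)

lemma star_lt_weight_balancedParts {m : ℕ} (hm : 15 ≤ m) :
    12 + 6 * m ^ 2 < weight (balancedParts m) := by
  rw [weight, balancedParts_prod (by omega)]
  have := sq_le_maxProd hm
  omega

lemma two_mul_lt_two_pow {t : ℕ} (ht : 3 ≤ t) : 2 * t < 2 ^ t := by
  induction t, ht using Nat.le_induction with
  | base => decide
  | succ t ht ih => rw [pow_succ]; omega

/-- Some multiset of positive integers with sum `m` has larger weight than `D`. -/
def Improvable (m : ℕ) (D : Multiset ℕ) : Prop :=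
  ∃ D' : Multiset ℕ, (∀ d ∈ D', 1 ≤ d) ∧ D'.sum = m ∧ weight D < weight D'

lemma improvable_of_le_star {m : ℕ} (hm : 15 ≤ m) {D : Multiset ℕ}
    (h : weight D ≤ 12 + 6 * m ^ 2) : Improvable m D :=
  ⟨balancedParts m, fun d hd => by rcases balancedParts_mem hd with rfl | rfl <;> omega,
    balancedParts_sum (by omega), h.trans_lt (star_lt_weight_balancedParts hm)⟩

/-- Replacing $a,b$ by $a-1,b+1$ changes the weight by $6(a-b-1)(R-1)$, where $R$ is the product of
the other parts. If $R=1$ the other parts are ones, and the weight does not exceed the star value.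
-/
lemma improvable_of_gap {S : Multiset ℕ} {a b m : ℕ} (hm : 15 ≤ m)
    (hpos : ∀ d ∈ a ::ₘ b ::ₘ S, 1 ≤ d) (hs : (a ::ₘ b ::ₘ S).sum = m) (hab : b + 2 ≤ a) :
    Improvable m (a ::ₘ b ::ₘ S) := by
  have hb := hpos b (by simp)
  have hS : ∀ d ∈ S, 1 ≤ d := fun d hd => hpos d (by simp [hd])
  have hR := one_le_prod hS
  obtain ⟨y, rfl⟩ := Nat.exists_eq_add_of_le' hb
  obtain ⟨z, rfl⟩ := Nat.exists_eq_add_of_le hab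
  rcases hR.lt_or_eq with h2 | h1
  · refine ⟨(y + 2 + z) ::ₘ (y + 2) ::ₘ S, ?_, ?_, ?_⟩
    · intro d hd
      simp only [Multiset.mem_cons] at hd
      rcases hd with rfl | rfl | hd
      exacts [by omega, by omega, hS d hd]
    · simp only [Multiset.sum_cons] at hs ⊢; omega
    · simp only [weight, Multiset.prod_cons, Multiset.card_cons, pairSum_cons,
        show y + 1 + 2 + z - 1 = y + 2 + z by omega, show y + 1 - 1 = y by omega,
        show y + 2 + z - 1 = y + 1 + z by omega, show y + 2 - 1 = y + 1 by omega]
      obtain ⟨r, hr⟩ := Nat.exists_eq_add_of_lt h2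
      rw [hr]
      ring_nf
      nlinarith [Nat.zero_le (z * r)]
  · apply improvable_of_le_star hm
    obtain ⟨K, rfl⟩ : ∃ K, S = Multiset.replicate K 1 := ⟨_, prod_eq_one_imp h1.symm⟩
    simp only [Multiset.sum_cons, Multiset.sum_replicate, smul_eq_mul, mul_one] at hs
    simp only [weight, Multiset.prod_cons, Multiset.card_cons, pairSum_cons,
      show y + 1 + 2 + z - 1 = y + 2 + z by omega, show y + 1 - 1 = y by omega,
      Multiset.prod_replicate, one_pow, Multiset.card_replicate, pairSum_replicate,
      Nat.sub_self, mul_zero, mul_one, add_zero]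
    subst hs
    ring_nf
    nlinarith [Nat.zero_le (z * y), Nat.zero_le (z * K), Nat.zero_le (y * K)]

/-- Split $a$ into $2$ and $a-2$. The product gains $(a-4)R$, and $R\ge 4$ because every other part
is at least 4; with the growth in the number of parts this outweighs the loss in `pairSum`. -/
lemma improvable_of_five_le {S : Multiset ℕ} {a m : ℕ} (hm : 15 ≤ m)
    (hbal : ∀ b ∈ S, a ≤ b + 1) (hs : (a ::ₘ S).sum = m) (ha : 5 ≤ a) :
    Improvable m (a ::ₘ S) := by
  obtain ⟨x, rfl⟩ := Nat.exists_eq_add_of_le ha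
  have hS : ∀ d ∈ S, 4 ≤ d := fun d hd => by have := hbal d hd; omega
  rcases Multiset.empty_or_exists_mem S with rfl | ⟨c, hc⟩
  · apply improvable_of_le_star hm
    simp only [Multiset.sum_cons, Multiset.sum_zero, add_zero] at hs
    subst hs
    simp [weight, show 5 + x - 1 = 4 + x by omega]
    nlinarith
  · have hR : 4 ≤ S.prod := (hS c hc).trans
      (Nat.le_of_dvd (one_le_prod fun d hd => by have := hS d hd; omega) (Multiset.dvd_prod hc))
    have hK : 1 ≤ S.card := Multiset.card_pos_iff_exists_mem.2 ⟨c, hc⟩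
    refine ⟨2 ::ₘ (3 + x) ::ₘ S, ?_, ?_, ?_⟩
    · intro d hd
      simp only [Multiset.mem_cons] at hd
      rcases hd with rfl | rfl | hd
      exacts [by omega, by omega, by have := hS d hd; omega]
    · simp only [Multiset.sum_cons] at hs ⊢; omega
    · simp only [weight, Multiset.prod_cons, Multiset.card_cons, pairSum_cons,
        show 5 + x - 1 = 4 + x by omega, show 3 + x - 1 = 2 + x by omega]
      nlinarith [Nat.mul_le_mul_right x hR]

/-- Two fours become $3,3,2$, turning the factor 16 into 18. A single four becomes $2,2$ with the
same product: the loss $3\cdot 8$ in `pairSum` is recovered by the square of the number of parts. -/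
lemma improvable_of_four_mem {S : Multiset ℕ} {m : ℕ} (hm : 15 ≤ m)
    (hpos : ∀ d ∈ S, 1 ≤ d) (hS : ∀ d ∈ S, d ≤ 4) (hs : (4 ::ₘ S).sum = m) :
    Improvable m (4 ::ₘ S) := by
  by_cases h4 : 4 ∈ S
  · obtain ⟨S, rfl⟩ := Multiset.exists_cons_of_mem h4
    have hpos' : ∀ d ∈ S, 1 ≤ d := fun d hd => hpos d (by simp [hd])
    have hR := one_le_prod hpos'
    refine ⟨3 ::ₘ 3 ::ₘ 2 ::ₘ S, ?_, ?_, ?_⟩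
    · intro d hd
      simp only [Multiset.mem_cons] at hd
      rcases hd with rfl | rfl | rfl | hd
      exacts [by omega, by omega, by omega, hpos' d hd]
    · simp only [Multiset.sum_cons] at hs ⊢; omega
    · simp only [weight, Multiset.prod_cons, Multiset.card_cons, pairSum_cons, Nat.reduceSub,
        Nat.reduceMul]
      nlinarith [Nat.zero_le S.card]
  · refine ⟨2 ::ₘ 2 ::ₘ S, ?_, ?_, ?_⟩
    · intro d hd
      simp only [Multiset.mem_cons] at hd
      rcases hd with rfl | rfl | hd
      exacts [by omega, by omega, hpos d hd]
    · simp only [Multiset.sum_cons] at hs ⊢; omega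
    · have hK := Multiset.sum_le_card_nsmul S 4 hS
      simp only [Multiset.sum_cons, smul_eq_mul] at hs hK
      have : 3 ≤ S.card := by omega
      simp only [weight, Multiset.prod_cons, Multiset.card_cons, pairSum_cons]
      nlinarith

lemma improvable_of_ones_twos {t j m : ℕ} (hm : 15 ≤ m) (hj : 1 ≤ j) (hs : 2 * t + j = m) :
    Improvable m (Multiset.replicate t 2 + Multiset.replicate j 1) := by
  rcases hj.lt_or_eq with hj2 | rfl
  · obtain ⟨i, rfl⟩ := Nat.exists_eq_add_of_le' hj2
    -- This is exactly the condition for merging two ones into a two to increase the weight; when it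
    -- fails, $2^t$ is small enough for the star to win.
    by_cases h : 8 * (t + (i + 2)) < 6 * 2 ^ t + 10
    · refine ⟨Multiset.replicate (t + 1) 2 + Multiset.replicate i 1, ?_, ?_, ?_⟩
      · intro d hd
        simp only [Multiset.mem_add, Multiset.mem_replicate] at hd
        omega
      · simp; omega
      · simp [weight, pow_succ]
        nlinarith
    · apply improvable_of_le_star hm
      simp [weight]
      subst hs
      nlinarith [Nat.zero_le (t * i)]
  · obtain ⟨u, rfl⟩ := Nat.exists_eq_add_of_le' (show 1 ≤ t by omega)
    refine ⟨3 ::ₘ Multiset.replicate u 2, ?_, ?_, ?_⟩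
    · intro d hd
      simp only [Multiset.mem_cons, Multiset.mem_replicate] at hd
      omega
    · simp; omega
    · have := two_mul_lt_two_pow (t := u) (by omega)
      simp [weight, pow_succ]
      nlinarith

/-- Three twos become two threes: the factor 8 becomes 9, and this gain dominates the linear loss
from having one part fewer. -/
lemma improvable_of_three_twos {a b m : ℕ} (hb : 3 ≤ b) (hs : 3 * a + 2 * b = m) :
    Improvable m (Multiset.replicate a 3 + Multiset.replicate b 2) := by
  obtain ⟨c, rfl⟩ := Nat.exists_eq_add_of_le' hb
  refine ⟨Multiset.replicate (a + 2) 3 + Multiset.replicate c 2, ?_, ?_, ?_⟩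
  · intro d hd
    simp only [Multiset.mem_add, Multiset.mem_replicate] at hd
    omega
  · simp; omega
  · have h1 : 2 ^ (a + c) ≤ 3 ^ a * 2 ^ c := by
      rw [pow_add]; exact Nat.mul_le_mul_right _ (Nat.pow_le_pow_left (by norm_num) a)
    have h2 : 8 * (a + c) + 2 < 6 * 2 ^ (a + c) := by
      rcases lt_or_ge (a + c) 3 with h | h
      · interval_cases (a + c) <;> decide
      · have := two_mul_lt_two_pow h; omega
    simp [weight, pow_succ]
    nlinarith

lemma improvable_of_ne {D : Multiset ℕ} {m : ℕ} (hm : 15 ≤ m) (hpos : ∀ d ∈ D, 1 ≤ d)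
    (hs : D.sum = m) (hne : D ≠ balancedParts m) : Improvable m D := by
  by_cases hgap : ∃ a b S, D = a ::ₘ b ::ₘ S ∧ b + 2 ≤ a
  · obtain ⟨a, b, S, rfl, hab⟩ := hgap
    exact improvable_of_gap hm hpos hs hab
  have hbal : ∀ a ∈ D, ∀ b ∈ D, a ≤ b + 1 := by
    by_contra! h
    obtain ⟨a, ha, b, hb, hab⟩ := h
    obtain ⟨S, rfl⟩ := Multiset.exists_cons_of_mem ha
    rcases Multiset.mem_cons.1 hb with rfl | hb
    · omega
    obtain ⟨S, rfl⟩ := Multiset.exists_cons_of_mem hb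
    exact hgap ⟨a, b, S, rfl, by omega⟩
  by_cases h5 : ∃ a ∈ D, 5 ≤ a
  · obtain ⟨a, ha, h5⟩ := h5
    obtain ⟨S, rfl⟩ := Multiset.exists_cons_of_mem ha
    exact improvable_of_five_le hm (fun b hb => hbal a ha b (by simp [hb])) hs h5
  push Not at h5
  by_cases h4 : 4 ∈ D
  · obtain ⟨S, rfl⟩ := Multiset.exists_cons_of_mem h4
    exact improvable_of_four_mem hm (fun d hd => hpos d (by simp [hd]))
      (fun d hd => by have := h5 d (by simp [hd]); omega) hs
  have h3 : ∀ d ∈ D, d ≤ 3 := fun d hd => by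
    have := h5 d hd
    have : d ≠ 4 := by rintro rfl; exact h4 hd
    omega
  by_cases h1 : 1 ∈ D
  · obtain ⟨t, j, rfl⟩ := exists_replicate_add (D := D) (x := 2) (y := 1) fun d hd => by
      have := hbal d hd 1 h1; have := hpos d hd; omega
    refine improvable_of_ones_twos hm ?_ (by simpa [mul_comm] using hs)
    simp only [Multiset.mem_add, Multiset.mem_replicate] at h1
    omega
  · obtain ⟨a, b, rfl⟩ := exists_replicate_add (D := D) (x := 3) (y := 2) fun d hd => by
      have := h3 d hd
      have := hpos d hd
      have : d ≠ 1 := by rintro rfl; exact h1 hd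
      omega
    have hs' : 3 * a + 2 * b = m := by simpa [mul_comm] using hs
    rcases le_or_gt b 2 with hb | hb
    · exact absurd (eq_balancedParts hb hs') hne
    · exact improvable_of_three_twos hb hs'

/-- Among multisets of positive integers with sum `m ≥ 15`, `balancedParts m` is the unique one of
maximal weight. -/
theorem weight_le_balancedParts {D : Multiset ℕ} {m : ℕ} (hm : 15 ≤ m) (hpos : ∀ d ∈ D, 1 ≤ d)
    (hs : D.sum = m) : weight D ≤ weight (balancedParts m) ∧
      (weight D = weight (balancedParts m) → D = balancedParts m) := by
  -- There are finitely many partitions, so a maximiser exists; it cannot be improved, hence it is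
  -- `balancedParts m`.
  obtain ⟨p, hp⟩ := Finite.exists_max fun p : m.Partition => weight p.parts
  have hmax : ∀ E : Multiset ℕ, (∀ d ∈ E, 1 ≤ d) → E.sum = m → weight E ≤ weight p.parts :=
    fun E hE hEs => hp ⟨E, fun {i} hi => hE i hi, hEs⟩
  have hpb : p.parts = balancedParts m := by
    by_contra h
    obtain ⟨E, hE, hEs, hlt⟩ :=
      improvable_of_ne hm (fun d hd => p.parts_pos hd) p.parts_sum h
    exact absurd (hmax E hE hEs) (not_le.2 hlt)
  rw [hpb] at hmax
  refine ⟨hmax D hpos hs, fun heq => ?_⟩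
  by_contra h
  obtain ⟨E, hE, hEs, hlt⟩ := improvable_of_ne hm hpos hs h
  exact absurd (hmax E hE hEs) (not_le.2 (heq ▸ hlt))

/-! ### The two colour classes together. -/

lemma classes_bound_aux {D E : Multiset ℕ} {m : ℕ} (hm : 1 ≤ m)
    (hD : ∀ d ∈ D, 1 ≤ d) (hE : ∀ d ∈ E, 1 ≤ d) (hDs : D.sum = m) (hEs : E.sum = m)
    (hc : D.card + E.card = m + 1) (hle : D.card ≤ E.card) :
    (m ≤ 14 → 4 * (D.prod + pairSum D + (E.prod + pairSum E)) < 12 + 6 * m ^ 2) ∧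
    (15 ≤ m → 4 * (D.prod + pairSum D + (E.prod + pairSum E)) < weight (balancedParts m)) := by
  have hE2 := (prod_add_pairSum_le_excess hE).2
  obtain ⟨e, he⟩ : ∃ e, D.card = e + 1 := by
    refine ⟨D.card - 1, ?_⟩
    have : D.card ≠ 0 := by
      rw [Ne, Multiset.card_eq_zero]; rintro rfl; simp at hDs; omega
    omega
  -- The excess of the larger class is one less than the size of the smaller class, hence at most
  -- $(m-1)/2$.
  rw [show E.sum - E.card = e by omega] at hE2
  constructor
  · intro h14
    have h1 := (small_bounds h14 hD hDs).1 (by omega)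
    have h2 : e ≤ (m - 1) / 2 := by omega
    have h3 : 2 ^ e + 2 * e + 2 ≤ 2 ^ ((m - 1) / 2) + 2 * ((m - 1) / 2) + 2 := by
      have := Nat.pow_le_pow_right (show 0 < 2 by norm_num) h2
      omega
    have h4 : 4 * (m * m + (2 ^ ((m - 1) / 2) + 2 * ((m - 1) / 2) + 2)) < 12 + 6 * m ^ 2 := by
      clear hD hE hDs hEs hc h1 h2 h3
      interval_cases m <;> decide
    omega
  · intro h15
    have hw : 6 * maxProd m + 4 * ((m + 2) / 3) ^ 2 + 6 * m ≤ weight (balancedParts m) + 12 := by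
      rw [weight, balancedParts_prod (by omega), balancedParts_card (by omega)]
      have := balancedParts_pairSum (m := m) (by omega)
      omega
    rcases hle.lt_or_eq with hlt | heq
    · have h1 := prod_add_pairSum_le (D := D) (by omega)
      rw [hDs] at h1
      have h2 := two_pow_le_maxProd h15
      have h3 : 2 * 2 ^ e ≤ 2 ^ (m / 2) := by
        rw [mul_comm, ← pow_succ]
        exact Nat.pow_le_pow_right (by norm_num) (by omega)
      have h4 : 5 * m ≤ 3 * ((m + 2) / 3) ^ 2 := by
        have : m ≤ 3 * ((m + 2) / 3) := by omega
        have : 5 ≤ (m + 2) / 3 := by omega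
        nlinarith
      omega
    -- Classes of equal size both have excess $e=(m-1)/2$, so the exponential bound serves for each
    -- of them.
    · have hD2 := (prod_add_pairSum_le_excess hD).2
      rw [show D.sum - D.card = e by omega] at hD2
      have hme : m = 2 * e + 1 := by omega
      have h1 := two_pow_le_maxProd_odd (e := e) (by omega)
      rw [← hme, pow_succ] at h1
      have : 25 ≤ ((m + 2) / 3) ^ 2 := by
        have : 5 ≤ (m + 2) / 3 := by omega
        nlinarith
      omega

/-- The bound on the two colour classes of a tree with `m` edges. -/
theorem classes_bound {D E : Multiset ℕ} {m : ℕ} (hm : 1 ≤ m)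
    (hD : ∀ d ∈ D, 1 ≤ d) (hE : ∀ d ∈ E, 1 ≤ d) (hDs : D.sum = m) (hEs : E.sum = m)
    (hc : D.card + E.card = m + 1) :
    (m ≤ 14 → 4 * (D.prod + pairSum D + (E.prod + pairSum E)) < 12 + 6 * m ^ 2) ∧
    (15 ≤ m → 4 * (D.prod + pairSum D + (E.prod + pairSum E)) < weight (balancedParts m)) := by
  rcases le_total D.card E.card with h | h
  · exact classes_bound_aux hm hD hE hDs hEs hc h
  · rw [add_comm (D.prod + pairSum D)]
    exact classes_bound_aux hm hE hD hEs hDs (by omega) h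

/-! ### Rooted trees and the sum of $M$ over a colour class. -/

open Finset SimpleGraph

/-- Remove a deepest element $b$: the product drops by $X(b)-1$ times the remaining product. That
product still contains the factor $X(g(b))$, since $g(b)$ is strictly less deep. -/
lemma prod_ge_telescope {α : Type*} [DecidableEq α] (s : Finset α) (r : α) (g : α → α)
    (dep X : α → ℕ) (hX : ∀ a, 1 ≤ X a) (hr : r ∈ s)
    (hg : ∀ a ∈ s, a ≠ r → g a ∈ s ∧ dep (g a) < dep a) :
    X r + ∑ a ∈ s.erase r, X (g a) * (X a - 1) ≤ ∏ a ∈ s, X a := by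
  induction hk : s.card generalizing s with
  | zero => rw [card_eq_zero.1 hk] at hr; simp at hr
  | succ k ih =>
    by_cases hs : s.erase r = ∅
    · have : s = {r} := by rw [← insert_erase hr, hs]; rfl
      subst this; simp
    obtain ⟨b, hb, hmax⟩ := exists_max_image (s.erase r) dep (nonempty_iff_ne_empty.2 hs)
    obtain ⟨hbr, hbs⟩ := mem_erase.1 hb
    have hb' := hg b hbs hbr
    have key := ih (s.erase b) (mem_erase.2 ⟨hbr.symm, hr⟩) (fun a ha har => ?_)
      (by rw [card_erase_of_mem hbs, hk]; rfl)
    · rw [← mul_prod_erase s X hbs, ← add_sum_erase _ _ hb, erase_right_comm]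
      have hgb : X (g b) ≤ ∏ a ∈ s.erase b, X a :=
        Nat.le_of_dvd (prod_pos fun a _ => hX a) (dvd_prod_of_mem X (mem_erase.2
          ⟨fun e => by have := hb'.2; rw [e] at this; omega, hb'.1⟩))
      obtain ⟨y, hy⟩ := Nat.exists_eq_add_of_le' (hX b)
      rw [hy, Nat.add_sub_cancel]
      nlinarith [Nat.mul_le_mul_right y hgb]
    · have ha' := mem_erase.1 ha
      obtain ⟨h1, h2⟩ := hg a ha'.2 har
      refine ⟨mem_erase.2 ⟨fun e => ?_, h1⟩, h2⟩
      have := hmax a (mem_erase.2 ⟨har, ha'.2⟩)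
      rw [e] at h2; omega

section Rooted

variable {V : Type*}

/-- `par` and `dep` are the parent and depth functions of the tree `G` rooted at `r`. -/
structure IsRooted (G : SimpleGraph V) (r : V) (par : V → V) (dep : V → ℕ) : Prop where
  dep_root : dep r = 0
  dep_par : ∀ u, u ≠ r → dep (par u) + 1 = dep u
  adj_iff : ∀ u v, G.Adj u v ↔ (u ≠ r ∧ par u = v) ∨ (v ≠ r ∧ par v = u)

/-- Geodesics from $r$ through $p$ and through $q$ are both paths to $u$; a tree has only one, so
their penultimate vertices agree. -/
lemma parent_unique {G : SimpleGraph V} (hG : G.IsTree) {r u p q : V} (hp : G.Adj p u)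
    (hq : G.Adj q u) (hdp : G.dist r p + 1 = G.dist r u) (hdq : G.dist r q + 1 = G.dist r u) :
    p = q := by
  obtain ⟨w, -, hw⟩ := hG.connected.exists_path_of_dist r p
  obtain ⟨w', -, hw'⟩ := hG.connected.exists_path_of_dist r q
  have h1 : (w.concat hp).IsPath :=
    (w.concat hp).isPath_of_length_eq_dist (by rw [Walk.length_concat, hw, hdp])
  have h2 : (w'.concat hq).IsPath :=
    (w'.concat hq).isPath_of_length_eq_dist (by rw [Walk.length_concat, hw', hdq])
  have h3 : w.concat hp = w'.concat hq :=
    Subtype.mk.inj ((hG.isAcyclic.subsingleton_path r u).elim ⟨_, h1⟩ ⟨_, h2⟩)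
  have := congrArg Walk.penultimate h3
  simpa using this

lemma exists_parent {G : SimpleGraph V} (hG : G.Connected) {r u : V} (hu : u ≠ r) :
    ∃ p, G.Adj p u ∧ G.dist r p + 1 = G.dist r u := by
  obtain ⟨w, hw, hl⟩ := hG.exists_path_of_dist r u
  have hnil : ¬ w.Nil := fun h => hu h.eq.symm
  have hadj : G.Adj w.penultimate u := w.adj_penultimate hnil
  refine ⟨_, hadj, ?_⟩
  have h1 : G.dist r w.penultimate ≤ w.dropLast.length := dist_le _
  have h2 : w.dropLast.length + 1 = w.length := by
    rw [← Walk.length_concat _ hadj, w.concat_dropLast hadj]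
  have h3 := hG.dist_triangle (u := r) (v := w.penultimate) (w := u)
  rw [dist_eq_one_iff_adj.2 hadj] at h3
  omega

lemma exists_isRooted {G : SimpleGraph V} (hG : G.IsTree) (r : V) :
    ∃ par : V → V, IsRooted G r par (G.dist r) := by
  classical
  have h : ∀ u, ∃ p, u ≠ r → G.Adj p u ∧ G.dist r p + 1 = G.dist r u := fun u => by
    by_cases hu : u = r
    · exact ⟨u, fun h => absurd hu h⟩
    · obtain ⟨p, hp⟩ := exists_parent hG.connected hu
      exact ⟨p, fun _ => hp⟩
  choose par hpar using h
  refine ⟨par, by simp, fun u hu => (hpar u hu).2, fun u v => ⟨fun h => ?_, ?_⟩⟩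
  · rcases hG.dist_eq_dist_add_one_of_adj r h with h1 | h1
    · have hu : u ≠ r := by rintro rfl; simp at h1
      exact Or.inl ⟨hu, parent_unique hG (hpar u hu).1 h.symm (hpar u hu).2 h1.symm⟩
    · have hv : v ≠ r := by rintro rfl; simp at h1
      exact Or.inr ⟨hv, parent_unique hG (hpar v hv).1 h (hpar v hv).2 h1.symm⟩
  · rintro (⟨hu, rfl⟩ | ⟨hv, rfl⟩)
    exacts [(hpar u hu).1.symm, (hpar v hv).1]

variable {G : SimpleGraph V} {r : V} {par : V → V} {dep : V → ℕ}

lemma IsRooted.connected (h : IsRooted G r par dep) : G.Connected := by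
  have hr : ∀ k u, dep u = k → G.Reachable r u := by
    intro k
    induction k with
    | zero =>
      intro u hu
      by_cases hur : u = r
      · rw [hur]
      · have := h.dep_par u hur; omega
    | succ k ih =>
      intro u hu
      have hur : u ≠ r := by rintro rfl; rw [h.dep_root] at hu; omega
      have := h.dep_par u hur
      exact (ih (par u) (by omega)).trans ((h.adj_iff _ _).2 (Or.inr ⟨hur, rfl⟩)).reachable
  have : Nonempty V := ⟨r⟩
  exact ⟨fun u v => (hr _ u rfl).symm.trans (hr _ v rfl)⟩

lemma IsRooted.isTree [Finite V] (h : IsRooted G r par dep) : G.IsTree := by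
  classical
  have := Fintype.ofFinite V
  refine isTree_iff_connected_and_card.2 ⟨h.connected, le_antisymm ?_
    h.connected.card_vert_le_card_edgeSet_add_one⟩
  have hsub : G.edgeFinset ⊆ (univ.erase r).image fun u => s(u, par u) := by
    intro e
    induction e using Sym2.ind with
    | _ u v =>
      rw [mem_edgeFinset, mem_edgeSet, h.adj_iff]
      rintro (⟨hu, rfl⟩ | ⟨hv, rfl⟩)
      · exact mem_image.2 ⟨u, by simp [hu], rfl⟩
      · exact mem_image.2 ⟨v, by simp [hv], Sym2.eq_swap⟩
  have hc := (card_le_card hsub).trans card_image_le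
  rw [card_erase_of_mem (mem_univ r), card_univ] at hc
  have hpos : 0 < Fintype.card V := Fintype.card_pos_iff.2 ⟨r⟩
  rw [Nat.card_eq_fintype_card, ← edgeFinset_card, Nat.card_eq_fintype_card]
  omega

open Classical in
/-- The children of `v`. -/
def children [Fintype V] (r : V) (par : V → V) (v : V) : Finset V :=
  univ.filter fun u => u ≠ r ∧ par u = v

@[simp] lemma mem_children [Fintype V] {u v : V} :
    u ∈ children r par v ↔ u ≠ r ∧ par u = v := by simp [children]

variable [Fintype V]

open Classical in
lemma IsRooted.neighborFinset_root (h : IsRooted G r par dep) :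
    G.neighborFinset r = children r par r := by
  ext v; simp [h.adj_iff]

open Classical in
lemma IsRooted.neighborFinset_ne (h : IsRooted G r par dep) {v : V} (hv : v ≠ r) :
    G.neighborFinset v = insert (par v) (children r par v) := by
  ext u; simp [h.adj_iff, hv, eq_comm]

lemma IsRooted.par_notMem (h : IsRooted G r par dep) {v : V} (hv : v ≠ r) :
    par v ∉ children r par v := by
  intro hc
  have h1 := mem_children.1 hc
  have h2 := h.dep_par _ h1.1
  have h3 := h.dep_par v hv
  rw [h1.2] at h2
  omega

open Classical in
lemma IsRooted.degree_ne (h : IsRooted G r par dep) {v : V} (hv : v ≠ r) :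
    G.degree v = (children r par v).card + 1 := by
  rw [← card_neighborFinset_eq_degree, h.neighborFinset_ne hv,
    card_insert_of_notMem (h.par_notMem hv)]

open Classical in
lemma IsRooted.prod_root (h : IsRooted G r par dep) :
    neighborDegreeProd G r = ∏ v ∈ children r par r, G.degree v := by
  rw [neighborDegreeProd, h.neighborFinset_root]

open Classical in
lemma IsRooted.prod_ne (h : IsRooted G r par dep) {u : V} (hu : u ≠ r) :
    neighborDegreeProd G u = G.degree (par u) * ∏ v ∈ children r par u, G.degree v := by
  rw [neighborDegreeProd, h.neighborFinset_ne hu, prod_insert (h.par_notMem hu)]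

/-- The vertices at even depth. -/
def evenPart (dep : V → ℕ) : Finset V := univ.filter fun u => dep u % 2 = 0

/-- The vertices at odd depth. -/
def oddPart (dep : V → ℕ) : Finset V := univ.filter fun u => dep u % 2 = 1

lemma card_evenPart_add (dep : V → ℕ) :
    (evenPart dep).card + (oddPart dep).card = Fintype.card V := by
  rw [← card_univ, ← card_filter_add_card_filter_not (s := univ) (fun u : V => dep u % 2 = 0)]
  congr 2
  ext u; simp [oddPart]

lemma IsRooted.ne_of_odd (h : IsRooted G r par dep) {v : V} (hv : v ∈ oddPart dep) : v ≠ r := by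
  rintro rfl
  simp [oddPart, h.dep_root] at hv

lemma IsRooted.root_mem (h : IsRooted G r par dep) : r ∈ evenPart dep := by
  simp [evenPart, h.dep_root]

open Classical in
lemma IsRooted.par_mem_odd (h : IsRooted G r par dep) {u : V} (hu : u ∈ (evenPart dep).erase r) :
    par u ∈ oddPart dep := by
  simp only [evenPart, oddPart, mem_erase, mem_filter, mem_univ, true_and] at hu ⊢
  have := h.dep_par u hu.1
  omega

lemma IsRooted.par_mem_even (h : IsRooted G r par dep) {u : V} (hu : u ∈ oddPart dep) :
    par u ∈ evenPart dep := by
  have := h.dep_par u (h.ne_of_odd hu)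
  simp only [evenPart, oddPart, mem_filter, mem_univ, true_and] at hu ⊢
  omega

open Classical in
lemma IsRooted.children_odd (h : IsRooted G r par dep) {v : V} (hv : v ∈ oddPart dep) :
    ((evenPart dep).erase r).filter (fun u => par u = v) = children r par v := by
  ext u
  simp only [evenPart, oddPart, mem_erase, mem_filter, mem_univ, true_and, mem_children] at hv ⊢
  constructor
  · rintro ⟨⟨h1, -⟩, h3⟩; exact ⟨h1, h3⟩
  · rintro ⟨h1, rfl⟩
    have := h.dep_par u h1
    exact ⟨⟨h1, by omega⟩, rfl⟩

open Classical in
lemma IsRooted.children_even (h : IsRooted G r par dep) {v : V} (hv : v ∈ evenPart dep) :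
    (oddPart dep).filter (fun u => par u = v) = children r par v := by
  ext u
  constructor
  · intro hu
    rw [mem_filter] at hu
    exact mem_children.2 ⟨h.ne_of_odd hu.1, hu.2⟩
  · intro hu
    rw [mem_children] at hu
    obtain ⟨h1, rfl⟩ := hu
    have := h.dep_par u h1
    simp only [evenPart, oddPart, mem_filter, mem_univ, true_and, and_true] at hv ⊢
    omega

open Classical in
lemma IsRooted.sum_odd_degree (h : IsRooted G r par dep) :
    ∑ v ∈ oddPart dep, G.degree v + 1 = Fintype.card V := by
  have h1 : ∑ v ∈ oddPart dep, G.degree v =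
      ∑ v ∈ oddPart dep, (((evenPart dep).erase r).filter fun u => par u = v).card
        + (oddPart dep).card := by
    rw [card_eq_sum_ones, ← sum_add_distrib]
    exact sum_congr rfl fun v hv => by rw [h.degree_ne (h.ne_of_odd hv), h.children_odd hv]
  rw [h1, ← card_eq_sum_card_fiberwise fun u hu => h.par_mem_odd hu,
    card_erase_of_mem h.root_mem, ← card_evenPart_add dep]
  have : 0 < (evenPart dep).card := card_pos.2 ⟨r, h.root_mem⟩
  omega

open Classical in
/-- The sum of `M(u)` over a colour class is bounded in terms of the degrees in the other class. -/
theorem IsRooted.sum_even_le (h : IsRooted G r par dep) :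
    ∑ u ∈ evenPart dep, neighborDegreeProd G u ≤
      ∏ v ∈ oddPart dep, G.degree v + ∑ v ∈ oddPart dep, G.degree v * (G.degree v - 1) := by
  -- Every odd vertex is a child of exactly one even vertex, so these products multiply to the
  -- product of all odd degrees.
  set X : V → ℕ := fun u => ∏ v ∈ children r par u, G.degree v with hXdef
  have hdeg : ∀ u v, v ∈ children r par u → 1 ≤ G.degree v := fun u v hv => by
    rw [h.degree_ne (mem_children.1 hv).1]; omega
  have hX : ∀ u, 1 ≤ X u := fun u =>
    Nat.succ_le_of_lt (prod_pos fun v hv => hdeg u v hv)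
  have hprod : ∏ u ∈ evenPart dep, X u = ∏ v ∈ oddPart dep, G.degree v := by
    rw [← prod_fiberwise_of_maps_to (fun v hv => h.par_mem_even hv)]
    exact prod_congr rfl fun u hu => by rw [h.children_even hu]
  have hsum : ∑ u ∈ (evenPart dep).erase r, G.degree (par u) =
      ∑ v ∈ oddPart dep, G.degree v * (G.degree v - 1) := by
    rw [← sum_fiberwise_of_maps_to (fun u hu => h.par_mem_odd hu)]
    refine sum_congr rfl fun v hv => ?_
    rw [h.children_odd hv, sum_congr rfl (g := fun _ => G.degree v)
      (fun u hu => by rw [(mem_children.1 hu).2]), sum_const, smul_eq_mul, mul_comm,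
      h.degree_ne (h.ne_of_odd hv), Nat.add_sub_cancel]
  have htel := prod_ge_telescope (evenPart dep) r (fun u => par (par u)) dep X hX h.root_mem
    (fun a ha har => by
      have h1 := h.par_mem_odd (mem_erase.2 ⟨har, ha⟩)
      refine ⟨h.par_mem_even h1, ?_⟩
      have := h.dep_par a har
      have := h.dep_par _ (h.ne_of_odd h1)
      omega)
  rw [← add_sum_erase _ _ h.root_mem, h.prod_root, ← hprod, ← hsum]
  refine le_trans ?_ (Nat.add_le_add_right htel _)
  rw [add_assoc, ← sum_add_distrib]
  refine Nat.add_le_add_left (sum_le_sum fun u hu => ?_) _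
  rw [h.prod_ne (mem_erase.1 hu).1]
  -- Write $M(u)=\deg(\mathrm{par}\,u)+\deg(\mathrm{par}\,u)(X(u)-1)$. The first terms sum to $\sum
  -- d(d-1)$; in the second the degree is bounded by $X$ of the grandparent, which is the telescoped
  -- term.
  have h1 : G.degree (par u) ≤ X (par (par u)) :=
    Nat.le_of_dvd (hX _) (dvd_prod_of_mem _ (mem_children.2
      ⟨h.ne_of_odd (h.par_mem_odd hu), rfl⟩))
  obtain ⟨y, hy⟩ := Nat.exists_eq_add_of_le' (hX u)
  change G.degree (par u) * X u ≤ _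
  rw [hy, Nat.add_sub_cancel, mul_add, mul_one]
  exact Nat.add_le_add_right (Nat.mul_le_mul_right y h1) _

end Rooted

/-! ### Distances in trees. -/

section Dist

variable {V : Type*} {G : SimpleGraph V}

/-- The edge $cc'$ separates $w$ from $x$, so the path between them runs through $c$. The induction
walks from $c$ to $x$; stepping back towards $w$ would give some vertex two parents. -/
lemma dist_add_of_cut (hG : G.IsTree) {w c c' x : V} (hadj : G.Adj c c')
    (hw : G.dist w c = G.dist w c' + 1) (hx : G.dist c' x = G.dist c x + 1) :
    G.dist w x = G.dist w c + G.dist c x := by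
  induction hk : G.dist c x using Nat.strong_induction_on generalizing x with
  | _ k ih =>
    by_cases hxc : x = c
    · subst hxc; simp at hk; omega
    obtain ⟨y, hyx, hy⟩ := exists_parent hG.connected hxc
    have hy' : G.dist c' y = G.dist c y + 1 := by
      have h1 := hG.dist_eq_dist_add_one_of_adj c' hyx
      have h2 := hG.dist_eq_dist_add_one_of_adj y hadj
      rw [dist_comm (u := y), dist_comm (u := y)] at h2
      omega
    have ihy := ih _ (by omega) hy' rfl
    rcases hG.dist_eq_dist_add_one_of_adj w hyx with h | h
    · exfalso
      by_cases hyc : y = c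
      · subst hyc
        have := parent_unique hG hyx.symm hadj.symm h.symm hw.symm
        subst this
        simp at hx
      · obtain ⟨z, hzy, hz⟩ := exists_parent hG.connected hyc
        have hz' : G.dist c' z = G.dist c z + 1 := by
          have h1 := hG.dist_eq_dist_add_one_of_adj c' hzy
          have h2 := hG.dist_eq_dist_add_one_of_adj z hadj
          rw [dist_comm (u := z), dist_comm (u := z)] at h2
          omega
        have ihz := ih _ (by omega) hz' rfl
        have := parent_unique hG hyx.symm hzy h.symm (by omega)
        subst this
        omega
    · omega

lemma dist_leaf (hG : G.Connected) {u v x : V} (hu : ∀ y, G.Adj u y → y = v) (hx : x ≠ u) :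
    G.dist u x = G.dist v x + 1 := by
  obtain ⟨p, hp, hd⟩ := exists_parent hG hx.symm
  rw [hu p hp.symm] at hd
  rw [dist_comm (u := u), dist_comm (u := v)]
  exact hd.symm

end Dist

/-! ### Eccentricities and trees with all eccentricities at least three. -/

section Index

variable {V : Type*} [Fintype V] {G : SimpleGraph V}

open Classical in
lemma degree_pos_of_connected (hG : G.Connected) (h2 : 2 ≤ Fintype.card V) (v : V) :
    1 ≤ G.degree v := by
  have : Nontrivial V := Fintype.one_lt_card_iff_nontrivial.1 h2
  exact hG.preconnected.degree_pos_of_nontrivial v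

open Classical in
/-- The multiset of degrees of a set of vertices. -/
def degrees (G : SimpleGraph V) (s : Finset V) : Multiset ℕ := s.val.map fun v => G.degree v

open Classical in
lemma mem_degrees {s : Finset V} {d : ℕ} : d ∈ degrees G s ↔ ∃ v ∈ s, G.degree v = d := by
  simp [degrees]

lemma card_degrees (s : Finset V) : (degrees G s).card = s.card := by
  simp [degrees]

open Classical in
lemma sum_degrees (s : Finset V) : (degrees G s).sum = ∑ v ∈ s, G.degree v := rfl

open Classical in
lemma prod_degrees (s : Finset V) : (degrees G s).prod = ∏ v ∈ s, G.degree v := rfl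

open Classical in
lemma pairSum_degrees (s : Finset V) :
    pairSum (degrees G s) = ∑ v ∈ s, G.degree v * (G.degree v - 1) := by
  simp only [pairSum, degrees, Multiset.map_map]; rfl

/-- In a tree, the vertices at odd distance from `r` are those at even distance from a
neighbour of `r`. -/
lemma oddPart_eq_evenPart (hG : G.IsTree) {r s : V} (h : G.Adj r s) :
    oddPart (G.dist r) = evenPart (G.dist s) := by
  ext u
  have := hG.dist_eq_dist_add_one_of_adj u h
  rw [dist_comm (u := u) (v := r), dist_comm (u := u) (v := s)] at this
  simp only [oddPart, evenPart, mem_filter, mem_univ, true_and]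
  omega

/-- Rooting at each end of an edge makes each colour class the even class once, so
`IsRooted.sum_even_le` applies to both. -/
lemma sum_neighborDegreeProd_bound (hG : G.IsTree) {m : ℕ} (hm : 1 ≤ m)
    (hV : Fintype.card V = m + 1) :
    (m ≤ 14 → 4 * ∑ u, neighborDegreeProd G u < 12 + 6 * m ^ 2) ∧
    (15 ≤ m → 4 * ∑ u, neighborDegreeProd G u < weight (balancedParts m)) := by
  classical
  have hdeg := degree_pos_of_connected hG.connected (by omega)
  obtain ⟨r⟩ := hG.connected.nonempty
  have hrd := hdeg r
  obtain ⟨s, hs⟩ := (G.degree_pos_iff_exists_adj r).1 hrd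
  obtain ⟨p, hp⟩ := exists_isRooted hG r
  obtain ⟨q, hq⟩ := exists_isRooted hG s
  have e1 := oddPart_eq_evenPart hG hs
  have e2 := oddPart_eq_evenPart hG hs.symm
  have b1 := hp.sum_even_le
  have b2 := hq.sum_even_le
  have s1 := hp.sum_odd_degree
  have s2 := hq.sum_odd_degree
  have hc := card_evenPart_add (G.dist r)
  rw [← e2] at b1 hc
  have htot : ∑ u, neighborDegreeProd G u =
      ∑ u ∈ oddPart (G.dist s), neighborDegreeProd G u +
      ∑ u ∈ evenPart (G.dist s), neighborDegreeProd G u := by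
    rw [← sum_filter_add_sum_filter_not univ (fun u => G.dist s u % 2 = 1)]
    congr 1
    apply sum_congr _ fun _ _ => rfl
    ext u; simp [evenPart]
  have key := classes_bound (D := degrees G (oddPart (G.dist r)))
    (E := degrees G (oddPart (G.dist s))) hm
    (fun d hd => by obtain ⟨v, -, rfl⟩ := mem_degrees.1 hd; exact hdeg v)
    (fun d hd => by obtain ⟨v, -, rfl⟩ := mem_degrees.1 hd; exact hdeg v)
    (by rw [sum_degrees]; omega) (by rw [sum_degrees]; omega)
    (by rw [card_degrees, card_degrees]; omega)
  simp only [prod_degrees, pairSum_degrees] at key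
  constructor
  · intro h; have := key.1 h; omega
  · intro h; have := key.2 h; omega

/-- The eccentricity of a vertex as a natural number. -/
abbrev ecc (G : SimpleGraph V) (u : V) : ℕ := (G.eccent u).toNat

lemma coe_ecc (hG : G.Connected) (u : V) : (ecc G u : ℕ∞) = G.eccent u := by
  obtain ⟨v, hv⟩ := G.exists_edist_eq_eccent_of_finite u
  rw [ecc, ENat.natCast_toNat]
  rw [← hv]
  exact edist_ne_top_iff_reachable.2 (hG u v)

lemma dist_le_ecc (hG : G.Connected) (u v : V) : G.dist u v ≤ ecc G u := by
  have h : G.edist u v ≤ G.eccent u := edist_le_eccent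
  rw [← coe_ecc hG, ← (hG u v).coe_dist_eq_edist] at h
  exact_mod_cast h

lemma exists_dist_eq_ecc (hG : G.Connected) (u : V) : ∃ v, G.dist u v = ecc G u := by
  obtain ⟨v, hv⟩ := G.exists_edist_eq_eccent_of_finite u
  rw [← coe_ecc hG, ← (hG u v).coe_dist_eq_edist] at hv
  exact ⟨v, by exact_mod_cast hv⟩

lemma ecc_le (hG : G.Connected) {u : V} {k : ℕ} (h : ∀ v, G.dist u v ≤ k) : ecc G u ≤ k := by
  obtain ⟨v, hv⟩ := exists_dist_eq_ecc hG u
  exact hv ▸ h v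

lemma twelve_augECI_le_of_three_le_ecc (h3 : ∀ u, 3 ≤ ecc G u) :
    12 * augECI G ≤ ((4 * ∑ u, neighborDegreeProd G u : ℕ) : ℝ) := by
  rw [augECI]
  push_cast
  rw [mul_sum, mul_sum]
  refine sum_le_sum fun u _ => ?_
  have h : (3 : ℝ) ≤ (ecc G u : ℝ) := by exact_mod_cast h3 u
  rw [mul_div_assoc', div_le_iff₀ (by linarith)]
  have : (0 : ℝ) ≤ neighborDegreeProd G u := by positivity
  nlinarith

/-- A vertex of minimal eccentricity in a tree whose distances are at most four has eccentricity
at most two. -/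
lemma ecc_le_two_of_center (hG : G.IsTree) (h4 : ∀ u v, G.dist u v ≤ 4) {c : V}
    (hc : ∀ u, ecc G c ≤ ecc G u) : ecc G c ≤ 2 := by
  by_contra! h3
  obtain ⟨w, hw⟩ := exists_dist_eq_ecc hG.connected c
  have hcw : c ≠ w := by rintro rfl; simp at hw; omega
  obtain ⟨c', hadj, hc'⟩ := exists_parent hG.connected hcw
  obtain ⟨w', hw'⟩ := exists_dist_eq_ecc hG.connected c'
  have h1 := hc c'
  have h2 := dist_le_ecc hG.connected c w'
  -- Moving from $c$ to $c'$, towards $w$, does not lower the eccentricity, so the vertex $w'$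
  -- farthest from $c'$ lies on the side of $c$. Then $d(w,w')\ge 2\varepsilon(c)-1\ge 5$.
  have h5 := hG.dist_eq_dist_add_one_of_adj w' hadj
  rw [dist_comm (u := w'), dist_comm (u := w')] at h5
  have := dist_add_of_cut hG hadj.symm hc'.symm (x := w') (by omega)
  rw [dist_comm (u := w) (v := c)] at this
  have := h4 w w'
  omega

end Index

lemma IsRooted.dist_le_add {V : Type*} {G : SimpleGraph V} {c : V} {par : V → V}
    (h : IsRooted G c par (G.dist c)) (u v : V) :
    G.dist u v ≤ G.dist c u + G.dist c v := by
  have := h.connected.dist_triangle (u := u) (v := c) (w := v)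
  rwa [dist_comm (u := u) (v := c)] at this

lemma IsRooted.dist_eq {V : Type*} {G : SimpleGraph V} {c : V} {par : V → V} {dep : V → ℕ}
    (h : IsRooted G c par dep) : G.dist c = dep := by
  have hlip : ∀ {u v : V} (w : G.Walk u v), dep v ≤ dep u + w.length := by
    intro u v w
    induction w with
    | nil => simp
    | cons hadj w ih =>
      rw [Walk.length_cons]
      rcases (h.adj_iff _ _).1 hadj with ⟨h1, rfl⟩ | ⟨h1, rfl⟩ <;> have := h.dep_par _ h1 <;> omega
  have hle : ∀ k u, dep u = k → G.dist c u ≤ k := by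
    intro k
    induction k with
    | zero =>
      intro u hu
      by_cases huc : u = c
      · simp [huc]
      · have := h.dep_par u huc; omega
    | succ k ih =>
      intro u hu
      have huc : u ≠ c := by rintro rfl; rw [h.dep_root] at hu; omega
      have h1 := h.dep_par u huc
      have h2 := ih (par u) (by omega)
      have h3 := h.connected.dist_triangle (u := c) (v := par u) (w := u)
      rw [dist_eq_one_iff_adj.2 ((h.adj_iff (par u) u).2 (Or.inr ⟨huc, rfl⟩))] at h3
      omega
  ext u
  obtain ⟨w, hw⟩ := h.connected.exists_walk_length_eq_dist c u
  have := hlip w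
  rw [h.dep_root] at this
  exact le_antisymm (hle _ u rfl) (by omega)

/-! ### Trees of depth at most two: the index formula and diameter three. -/

section DepthTwo

variable {V : Type*} [Fintype V] {G : SimpleGraph V} {c : V} {par : V → V}

lemma IsRooted.oddPart_eq (h : IsRooted G c par (G.dist c)) (h2 : ∀ v, G.dist c v ≤ 2) :
    oddPart (G.dist c) = children c par c := by
  ext u
  have hG := h.connected
  constructor
  · intro hu
    have hur := h.ne_of_odd hu
    have h1 := h.dep_par u hur
    have := h2 u
    simp only [oddPart, mem_filter, mem_univ, true_and] at hu
    exact mem_children.2 ⟨hur, (hG.dist_eq_zero_iff.1 (show G.dist c (par u) = 0 by omega)).symm⟩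
  · intro hu
    obtain ⟨h1, h3⟩ := mem_children.1 hu
    have := h.dep_par u h1
    rw [h3, dist_self] at this
    simp only [oddPart, mem_filter, mem_univ, true_and]
    omega

lemma IsRooted.sum_split (h : IsRooted G c par (G.dist c)) (h2 : ∀ v, G.dist c v ≤ 2)
    (f : V → ℝ) : ∑ u, f u = f c + ∑ v ∈ children c par c, f v +
      ∑ v ∈ children c par c, ∑ u ∈ children c par v, f u := by
  classical
  have htot : ∑ u, f u =
      ∑ u ∈ oddPart (G.dist c), f u + ∑ u ∈ evenPart (G.dist c), f u := by
    rw [← sum_filter_add_sum_filter_not univ (fun u => G.dist c u % 2 = 1)]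
    congr 1
    apply sum_congr _ fun _ _ => rfl
    ext u; simp [evenPart]
  have hfib : ∑ u ∈ (evenPart (G.dist c)).erase c, f u =
      ∑ v ∈ oddPart (G.dist c), ∑ u ∈ children c par v, f u := by
    rw [← sum_fiberwise_of_maps_to (fun u hu => h.par_mem_odd hu)]
    exact sum_congr rfl fun v hv => by rw [h.children_odd hv]
  rw [htot, ← add_sum_erase _ _ h.root_mem, hfib, h.oddPart_eq h2]
  ring

lemma IsRooted.dist_child (h : IsRooted G c par (G.dist c)) {v : V}
    (hv : v ∈ children c par c) : G.dist c v = 1 := by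
  obtain ⟨h1, h3⟩ := mem_children.1 hv
  have := h.dep_par v h1
  rw [h3, dist_self] at this
  exact this.symm

lemma IsRooted.dist_grandchild (h : IsRooted G c par (G.dist c)) {u v : V}
    (hv : v ∈ children c par c) (hu : u ∈ children c par v) : G.dist c u = 2 := by
  obtain ⟨h1, h3⟩ := mem_children.1 hu
  have := h.dep_par u h1
  rw [h3, h.dist_child hv] at this
  exact this.symm

lemma IsRooted.children_grandchild (h : IsRooted G c par (G.dist c)) (h2 : ∀ v, G.dist c v ≤ 2)
    {u v : V} (hv : v ∈ children c par c) (hu : u ∈ children c par v) :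
    children c par u = ∅ := by
  rw [eq_empty_iff_forall_notMem]
  intro w hw
  obtain ⟨h1, h3⟩ := mem_children.1 hw
  have := h.dep_par w h1
  rw [h3, h.dist_grandchild hv hu] at this
  have := h2 w
  omega

lemma IsRooted.adj_grandchild (h : IsRooted G c par (G.dist c)) (h2 : ∀ v, G.dist c v ≤ 2)
    {u v : V} (hv : v ∈ children c par c) (hu : u ∈ children c par v) (y : V)
    (hy : G.Adj u y) : y = v := by
  rcases (h.adj_iff u y).1 hy with ⟨-, h1⟩ | ⟨h1, h3⟩
  · rw [← h1, (mem_children.1 hu).2]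
  · have : y ∈ children c par u := mem_children.2 ⟨h1, h3⟩
    rw [h.children_grandchild h2 hv hu] at this
    simp at this

open Classical in
lemma IsRooted.prod_child (h : IsRooted G c par (G.dist c)) (h2 : ∀ v, G.dist c v ≤ 2)
    {v : V} (hv : v ∈ children c par c) :
    neighborDegreeProd G v = (children c par c).card := by
  obtain ⟨h1, h3⟩ := mem_children.1 hv
  rw [h.prod_ne h1, h3, ← card_neighborFinset_eq_degree, h.neighborFinset_root,
    prod_eq_one fun u hu => ?_, mul_one]
  rw [h.degree_ne (mem_children.1 hu).1, h.children_grandchild h2 hv hu, card_empty, zero_add]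

open Classical in
lemma IsRooted.prod_grandchild (h : IsRooted G c par (G.dist c)) (h2 : ∀ v, G.dist c v ≤ 2)
    {u v : V} (hv : v ∈ children c par c) (hu : u ∈ children c par v) :
    neighborDegreeProd G u = G.degree v := by
  obtain ⟨h1, h3⟩ := mem_children.1 hu
  rw [h.prod_ne h1, h3, h.children_grandchild h2 hv hu, prod_empty, mul_one]

open Classical in
lemma IsRooted.augECI_eq (h : IsRooted G c par (G.dist c)) (h2 : ∀ v, G.dist c v ≤ 2) :
    augECI G = ((∏ v ∈ children c par c, G.degree v : ℕ) : ℝ) / ecc G c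
      + ∑ v ∈ children c par c, ((children c par c).card : ℝ) / ecc G v
      + ∑ v ∈ children c par c, ∑ u ∈ children c par v, (G.degree v : ℝ) / ecc G u := by
  rw [augECI, h.sum_split h2, h.prod_root]
  congr 1
  · congr 1
    exact sum_congr rfl fun v hv => by rw [h.prod_child h2 hv]
  · exact sum_congr rfl fun v hv => sum_congr rfl fun u hu => by rw [h.prod_grandchild h2 hv hu]

lemma IsRooted.two_le_dist_children (h : IsRooted G c par (G.dist c)) {a b : V}
    (ha : a ∈ children c par c) (hb : b ∈ children c par c) (hab : a ≠ b) :
    2 ≤ G.dist a b := by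
  refine h.connected.one_lt_dist_of_ne_of_not_adj hab fun hadj => ?_
  rw [mem_children] at ha hb
  rcases (h.adj_iff a b).1 hadj with ⟨-, h1⟩ | ⟨-, h1⟩
  · exact hb.1 (h1.symm.trans ha.2)
  · exact ha.1 (h1.symm.trans hb.2)

/-- A vertex below `a` is at distance at least three from the other children of the root. -/
lemma IsRooted.three_le_dist (h : IsRooted G c par (G.dist c)) (h2 : ∀ v, G.dist c v ≤ 2)
    {a b u : V} (ha : a ∈ children c par c) (hb : b ∈ children c par c) (hab : a ≠ b)
    (hu : u ∈ children c par a) : 3 ≤ G.dist u b := by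
  rw [dist_leaf h.connected (h.adj_grandchild h2 ha hu) (fun e => ?_)]
  · have := h.two_le_dist_children ha hb hab; omega
  · subst e
    have := h.dist_child hb
    rw [h.dist_grandchild ha hu] at this
    omega

lemma IsRooted.four_le_dist (h : IsRooted G c par (G.dist c)) (h2 : ∀ v, G.dist c v ≤ 2)
    {a b u w : V} (ha : a ∈ children c par c) (hb : b ∈ children c par c) (hab : a ≠ b)
    (hu : u ∈ children c par a) (hw : w ∈ children c par b) : 4 ≤ G.dist u w := by
  rw [dist_comm, dist_leaf h.connected (h.adj_grandchild h2 hb hw) (fun e => ?_), dist_comm]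
  · have := h.three_le_dist h2 ha hb hab hu; omega
  · subst e
    exact hab ((mem_children.1 hu).2.symm.trans (mem_children.1 hw).2)

/-- The root has two children that are not leaves. -/
def TwoBranches (c : V) (par : V → V) : Prop :=
  ∃ a ∈ children c par c, ∃ b ∈ children c par c, a ≠ b ∧
    (children c par a).Nonempty ∧ (children c par b).Nonempty

lemma TwoBranches.exists_ne (h : TwoBranches c par) (v : V) :
    ∃ a ∈ children c par c, a ≠ v ∧ (children c par a).Nonempty := by
  obtain ⟨a, ha, b, hb, hab, ha', hb'⟩ := h
  by_cases hv : a = v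
  · exact ⟨b, hb, fun e => hab (hv.trans e.symm), hb'⟩
  · exact ⟨a, ha, hv, ha'⟩

lemma IsRooted.ecc_root (h : IsRooted G c par (G.dist c)) (h2 : ∀ v, G.dist c v ≤ 2)
    (hb : TwoBranches c par) : ecc G c = 2 := by
  refine le_antisymm (ecc_le h.connected h2) ?_
  obtain ⟨a, ha, -, u, hu⟩ := hb.exists_ne c
  rw [← h.dist_grandchild ha hu]
  exact dist_le_ecc h.connected _ _

lemma IsRooted.ecc_child (h : IsRooted G c par (G.dist c)) (h2 : ∀ v, G.dist c v ≤ 2)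
    (hb : TwoBranches c par) {v : V} (hv : v ∈ children c par c) : ecc G v = 3 := by
  refine le_antisymm (ecc_le h.connected fun w => ?_) ?_
  · have := h.dist_le_add v w
    have := h2 w
    have := h.dist_child hv
    omega
  · obtain ⟨a, ha, hav, u, hu⟩ := hb.exists_ne v
    have := h.three_le_dist h2 ha hv hav hu
    rw [dist_comm] at this
    exact this.trans (dist_le_ecc h.connected _ _)

lemma IsRooted.ecc_grandchild (h : IsRooted G c par (G.dist c)) (h2 : ∀ v, G.dist c v ≤ 2)
    (hb : TwoBranches c par) {u v : V} (hv : v ∈ children c par c) (hu : u ∈ children c par v) :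
    ecc G u = 4 := by
  refine le_antisymm (ecc_le h.connected fun w => ?_) ?_
  · have := h.dist_le_add u w
    have := h2 w
    have := h2 u
    omega
  · obtain ⟨a, ha, hav, w, hw⟩ := hb.exists_ne v
    exact (h.four_le_dist h2 hv ha hav.symm hu hw).trans (dist_le_ecc h.connected _ _)

lemma IsRooted.sum_degrees_children (h : IsRooted G c par (G.dist c))
    (h2 : ∀ v, G.dist c v ≤ 2) :
    (degrees G (children c par c)).sum + 1 = Fintype.card V := by
  rw [sum_degrees, ← h.oddPart_eq h2]
  exact h.sum_odd_degree

lemma IsRooted.one_le_degrees_children (h : IsRooted G c par (G.dist c)) :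
    ∀ d ∈ degrees G (children c par c), 1 ≤ d := by
  intro d hd
  obtain ⟨v, hv, rfl⟩ := mem_degrees.1 hd
  rw [h.degree_ne (mem_children.1 hv).1]
  omega

theorem IsRooted.twelve_augECI (h : IsRooted G c par (G.dist c)) (h2 : ∀ v, G.dist c v ≤ 2)
    (hb : TwoBranches c par) :
    12 * augECI G = (weight (degrees G (children c par c)) : ℝ) := by
  classical
  have h3 : ∑ v ∈ children c par c, ((children c par c).card : ℝ) / ecc G v =
      ((children c par c).card : ℝ) ^ 2 / 3 := by
    rw [sum_congr rfl (g := fun _ => ((children c par c).card : ℝ) / 3)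
      fun v hv => by rw [h.ecc_child h2 hb hv]; norm_num, sum_const, nsmul_eq_mul]
    ring
  have h4 : ∑ v ∈ children c par c, ∑ u ∈ children c par v, (G.degree v : ℝ) / ecc G u =
      ((∑ v ∈ children c par c, G.degree v * (G.degree v - 1) : ℕ) : ℝ) / 4 := by
    rw [Nat.cast_sum, sum_div]
    refine sum_congr rfl fun v hv => ?_
    rw [sum_congr rfl (g := fun _ => (G.degree v : ℝ) / 4)
      fun u hu => by rw [h.ecc_grandchild h2 hb hv hu]; norm_num, sum_const, nsmul_eq_mul,
      h.degree_ne (mem_children.1 hv).1, Nat.add_sub_cancel]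
    push_cast
    ring
  rw [h.augECI_eq h2, h.ecc_root h2 hb, h3, h4, weight, prod_degrees, card_degrees,
    pairSum_degrees]
  push_cast
  ring

lemma div_nat_le {x : ℝ} (hx : 0 ≤ x) {e k : ℕ} (hk : 0 < k) (h : k ≤ e) : x / e ≤ x / k := by
  have : (0 : ℝ) < k := by exact_mod_cast hk
  exact div_le_div_of_nonneg_left hx this (by exact_mod_cast h)

/-- Trees of diameter three. -/
theorem IsRooted.twelve_augECI_lt_star (h : IsRooted G c par (G.dist c))
    (h2 : ∀ v, G.dist c v ≤ 2) (hecc : ∀ u, 2 ≤ ecc G u) (hb : ¬ TwoBranches c par)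
    {m : ℕ} (hm : Fintype.card V = m + 1) : 12 * augECI G < ((12 + 6 * m ^ 2 : ℕ) : ℝ) := by
  classical
  have hG := h.connected
  obtain ⟨u₀, hu₀⟩ := exists_dist_eq_ecc hG c
  have hu₀2 : G.dist c u₀ = 2 := le_antisymm (h2 _) (hu₀ ▸ hecc c)
  have hu₀c : u₀ ≠ c := by rintro rfl; simp at hu₀2
  obtain ⟨a, ha⟩ : ∃ a, par u₀ = a := ⟨_, rfl⟩
  have hda := h.dep_par u₀ hu₀c
  have haN : a ∈ children c par c := by
    rw [← h.oddPart_eq h2]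
    simp only [oddPart, mem_filter, mem_univ, true_and]
    rw [← ha]; omega
  have hu₀a : u₀ ∈ children c par a := mem_children.2 ⟨hu₀c, ha⟩
  have hleaf : ∀ v ∈ (children c par c).erase a, children c par v = ∅ := by
    intro v hv
    by_contra hne
    obtain ⟨hva, hvN⟩ := mem_erase.1 hv
    exact hb ⟨v, hvN, a, haN, hva, nonempty_iff_ne_empty.2 hne, ⟨u₀, hu₀a⟩⟩
  have hadj : G.Adj a c := (h.adj_iff _ _).2 (Or.inl (mem_children.1 haN))
  obtain ⟨b, hbN⟩ : ((children c par c).erase a).Nonempty := by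
    rw [nonempty_iff_ne_empty]
    intro hem
    -- If `a` were the only child of the root, it would be adjacent to every other vertex.
    have hle : ecc G a ≤ 1 := ecc_le hG fun w => by
      by_cases hw : w = a
      · simp [hw]
      refine (dist_eq_one_iff_adj.2 ?_).le
      by_cases hwc : w = c
      · rw [hwc]; exact hadj
      rw [h.adj_iff]
      refine Or.inr ⟨hwc, ?_⟩
      have hwd := h.dep_par w hwc
      have hw2 := h2 w
      by_cases hw1 : par w = c
      · exact absurd (mem_erase.2 ⟨hw, mem_children.2 ⟨hwc, hw1⟩⟩) (by rw [hem]; simp)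
      by_contra hpa
      refine absurd (mem_erase.2 ⟨hpa, ?_⟩) (by rw [hem]; exact notMem_empty (par w))
      rw [← h.oddPart_eq h2]
      have : G.dist c (par w) ≠ 0 := fun e => hw1 (hG.dist_eq_zero_iff.1 e).symm
      simp only [oddPart, mem_filter, mem_univ, true_and]
      omega
    have := hecc a
    omega
  obtain ⟨hba, hbc⟩ := mem_erase.1 hbN
  have hdeg1 : ∀ v ∈ (children c par c).erase a, G.degree v = 1 := fun v hv => by
    rw [h.degree_ne (mem_children.1 (mem_erase.1 hv).2).1, hleaf v hv, card_empty]
  have hsum := h.sum_degrees_children h2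
  rw [sum_degrees, ← add_sum_erase _ _ haN, sum_congr rfl hdeg1, sum_const, smul_eq_mul,
    mul_one] at hsum
  have hk1 : 1 ≤ ((children c par c).erase a).card := card_pos.2 ⟨b, hbN⟩
  have hkk : (children c par c).card = ((children c par c).erase a).card + 1 :=
    (card_erase_add_one haN).symm
  have hdegA := h.degree_ne (mem_children.1 haN).1
  have hx1 : 1 ≤ (children c par a).card := card_pos.2 ⟨u₀, hu₀a⟩
  rw [h.augECI_eq h2, ← mul_prod_erase _ _ haN, prod_congr rfl hdeg1, prod_const_one, mul_one,
    ← add_sum_erase (children c par c) (fun v => ((children c par c).card : ℝ) / ecc G v) haN,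
    ← add_sum_erase (children c par c)
      (fun v => ∑ u ∈ children c par v, (G.degree v : ℝ) / ecc G u) haN,
    sum_eq_zero (s := (children c par c).erase a)
      (f := fun v => ∑ u ∈ children c par v, (G.degree v : ℝ) / ecc G u)
      (fun v hv => by rw [hleaf v hv, sum_empty])]
  -- The tree is a double star with centres `c` and `a`: these two have eccentricity at least 2, all
  -- leaves at least 3.
  have e1 : (G.degree a : ℝ) / ecc G c ≤ (G.degree a : ℝ) / (2 : ℕ) :=
    div_nat_le (by positivity) (by norm_num) (hecc c)
  have e2 : ((children c par c).card : ℝ) / ecc G a ≤ ((children c par c).card : ℝ) / (2 : ℕ) :=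
    div_nat_le (by positivity) (by norm_num) (hecc a)
  have e3 : ∑ v ∈ (children c par c).erase a, ((children c par c).card : ℝ) / ecc G v ≤
      ∑ v ∈ (children c par c).erase a, ((children c par c).card : ℝ) / (3 : ℕ) :=
    sum_le_sum fun v hv => div_nat_le (by positivity) (by norm_num) (by
      have := h.three_le_dist h2 haN (mem_erase.1 hv).2 (mem_erase.1 hv).1.symm hu₀a
      rw [dist_comm] at this
      exact this.trans (dist_le_ecc hG _ _))
  have e4 : ∑ u ∈ children c par a, (G.degree a : ℝ) / ecc G u ≤
      ∑ u ∈ children c par a, (G.degree a : ℝ) / (3 : ℕ) :=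
    sum_le_sum fun u hu => div_nat_le (by positivity) (by norm_num) (
      (h.three_le_dist h2 haN hbc hba.symm hu).trans (dist_le_ecc hG _ _))
  rw [sum_const, nsmul_eq_mul] at e3 e4
  rw [hkk] at e2 e3 ⊢
  rw [hdegA] at e1 e4 hsum ⊢
  obtain ⟨x, hx⟩ := Nat.exists_eq_add_of_le' hx1
  obtain ⟨y, hy⟩ := Nat.exists_eq_add_of_le' hk1
  rw [hx] at e1 e4 hsum ⊢
  rw [hy] at e2 e3 hsum ⊢
  obtain rfl : m = x + y + 3 := by omega
  push_cast at e1 e2 e3 e4 ⊢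
  have hx0 : (0 : ℝ) ≤ x := by positivity
  have hy0 : (0 : ℝ) ≤ y := by positivity
  nlinarith [mul_nonneg hx0 hy0]

end DepthTwo

/-! ### Isomorphism invariance, and reconstruction from the degrees. -/

section Iso

variable {V W : Type*} {G : SimpleGraph V} {H : SimpleGraph W}

lemma edist_map_le (f : G →g H) (u v : V) : H.edist (f u) (f v) ≤ G.edist u v := by
  by_cases h : G.edist u v = ⊤
  · rw [h]; exact le_top
  · obtain ⟨w, hw⟩ := exists_walk_of_edist_ne_top h
    rw [← hw, ← Walk.length_map f w]
    exact edist_le _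

lemma edist_iso (f : G ≃g H) (u v : V) : H.edist (f u) (f v) = G.edist u v := by
  refine le_antisymm (edist_map_le f.toHom u v) ?_
  have := edist_map_le f.symm.toHom (f u) (f v)
  simpa using this

lemma eccent_iso (f : G ≃g H) (u : V) : H.eccent (f u) = G.eccent u := by
  rw [eccent, eccent, ← f.toEquiv.iSup_comp]
  exact iSup_congr fun v => edist_iso f u v

theorem augECI_iso [Fintype V] [Fintype W] (f : G ≃g H) : augECI G = augECI H := by
  classical
  refine Fintype.sum_equiv f.toEquiv _ _ fun u => ?_
  have h1 : neighborDegreeProd G u = neighborDegreeProd H (f u) := by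
    refine Finset.prod_equiv f.toEquiv (fun v => ?_) (fun v _ => ?_)
    · simp [mem_neighborFinset, f.map_adj_iff]
    · exact (f.degree_eq v).symm
  change (neighborDegreeProd G u : ℝ) / _ = (neighborDegreeProd H (f u) : ℝ) / _
  rw [h1, ← eccent_iso f u]
  rfl

/-- A bijection of index sets along which the fibres of `p` and `q` have equal sizes lifts. -/
lemma exists_equiv_of_card_fiber {A B I J : Type*} [Finite A] [Finite B] (p : A → I) (q : B → J)
    (σ : I ≃ J) (h : ∀ i, Nat.card {a // p a = i} = Nat.card {b // q b = σ i}) :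
    ∃ e : A ≃ B, ∀ a, q (e a) = σ (p a) := by
  have e' : ∀ i, {a // p a = i} ≃ {b // q b = σ i} := fun i =>
    Classical.choice (Finite.card_eq.1 (h i))
  refine ⟨(Equiv.sigmaFiberEquiv p).symm.trans ((Equiv.sigmaCongr σ e').trans
    (Equiv.sigmaFiberEquiv q)), fun a => ?_⟩
  exact (e' (p a) ⟨a, rfl⟩).2

end Iso

section DepthTwoIso

variable {V W : Type*} [Fintype V] [Fintype W] {G : SimpleGraph V} {H : SimpleGraph W}
  {c : V} {c' : W} {par : V → V} {par' : W → W}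

lemma IsRooted.trichotomy (h : IsRooted G c par (G.dist c)) (h2 : ∀ v, G.dist c v ≤ 2) (u : V) :
    u = c ∨ u ∈ children c par c ∨ ∃ v ∈ children c par c, u ∈ children c par v := by
  by_cases hu : u = c
  · exact Or.inl hu
  refine Or.inr ?_
  have h1 := h.dep_par u hu
  have h3 := h2 u
  by_cases hp : par u = c
  · exact Or.inl (mem_children.2 ⟨hu, hp⟩)
  · refine Or.inr ⟨par u, ?_, mem_children.2 ⟨hu, rfl⟩⟩
    rw [← h.oddPart_eq h2]
    have : G.dist c (par u) ≠ 0 := fun e => hp (h.connected.dist_eq_zero_iff.1 e).symm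
    simp only [oddPart, mem_filter, mem_univ, true_and]
    omega

open Classical in
lemma card_degree_fiber (s : Finset V) (d : ℕ) :
    Nat.card {v : {v // v ∈ s} // G.degree v.1 = d} = Multiset.count d (degrees G s) := by
  rw [degrees, Multiset.count_map, Nat.card_eq_fintype_card,
    Fintype.card_congr (Equiv.subtypeSubtypeEquivSubtypeInter (· ∈ s) (fun v => G.degree v = d)),
    Fintype.card_subtype, ← Finset.filter_val, ← Finset.card_def]
  congr 1
  ext v; simp [eq_comm]

lemma IsRooted.par_mem_children (h : IsRooted G c par (G.dist c)) (h2 : ∀ v, G.dist c v ≤ 2)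
    {u : V} (hu : u ≠ c) (hp : par u ≠ c) : par u ∈ children c par c := by
  rcases h.trichotomy h2 u with h1 | h1 | ⟨v, hv, h1⟩
  · exact absurd h1 hu
  · exact absurd (mem_children.1 h1).2 hp
  · rwa [(mem_children.1 h1).2]

open Classical in
lemma IsRooted.card_par_fiber (h : IsRooted G c par (G.dist c)) (h2 : ∀ v, G.dist c v ≤ 2)
    (v : {v // v ∈ children c par c}) :
    Nat.card {u : {u // u ≠ c ∧ par u ≠ c} //
      (⟨par u.1, h.par_mem_children h2 u.2.1 u.2.2⟩ : {v // v ∈ children c par c}) = v} + 1 =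
      G.degree v.1 := by
  have hv := (mem_children.1 v.2).1
  rw [h.degree_ne hv, Nat.card_eq_fintype_card, ← Fintype.card_coe]
  congr 1
  refine Fintype.card_congr ⟨fun u => ⟨u.1.1, mem_children.2 ⟨u.1.2.1, congrArg Subtype.val u.2⟩⟩,
    fun u => ⟨⟨u.1, (mem_children.1 u.2).1, by rw [(mem_children.1 u.2).2]; exact hv⟩,
      Subtype.ext (mem_children.1 u.2).2⟩, fun _ => rfl, fun _ => rfl⟩

/-- Trees of depth at most two are determined by the degrees of the children of the root. -/
theorem nonempty_iso_of_degrees_eq (h : IsRooted G c par (G.dist c))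
    (h2 : ∀ v, G.dist c v ≤ 2) (h' : IsRooted H c' par' (H.dist c'))
    (h2' : ∀ v, H.dist c' v ≤ 2)
    (hd : degrees G (children c par c) = degrees H (children c' par' c'))
    (hcard : Fintype.card V = Fintype.card W) : Nonempty (G ≃g H) := by
  classical
  obtain ⟨e₁, he₁⟩ : ∃ e : {v // v ∈ children c par c} ≃ {v // v ∈ children c' par' c'},
      ∀ v, H.degree (e v).1 = G.degree v.1 := by
    refine exists_equiv_of_card_fiber (fun v : {v // v ∈ children c par c} => G.degree v.1)
      (fun v : {v // v ∈ children c' par' c'} => H.degree v.1) (Equiv.refl ℕ) fun d => ?_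
    rw [card_degree_fiber, hd, ← card_degree_fiber]
    rfl
  -- Matched children have equal degrees, hence equally many children of their own, so the matching
  -- lifts to the next level.
  obtain ⟨e₂, he₂⟩ := exists_equiv_of_card_fiber
    (fun u : {u // u ≠ c ∧ par u ≠ c} =>
      (⟨par u.1, h.par_mem_children h2 u.2.1 u.2.2⟩ : {v // v ∈ children c par c}))
    (fun u : {u // u ≠ c' ∧ par' u ≠ c'} =>
      (⟨par' u.1, h'.par_mem_children h2' u.2.1 u.2.2⟩ : {v // v ∈ children c' par' c'}))
    e₁ fun v => by
      have a1 := h.card_par_fiber h2 v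
      have a2 := h'.card_par_fiber h2' (e₁ v)
      have a3 := he₁ v
      omega
  let f : V → W := fun u =>
    if hu : u = c then c' else if hp : par u = c then (e₁ ⟨u, mem_children.2 ⟨hu, hp⟩⟩).1
    else (e₂ ⟨u, hu, hp⟩).1
  have fc : f c = c' := by simp [f]
  have f1 : ∀ u (hu : u ∈ children c par c), f u = (e₁ ⟨u, hu⟩).1 := fun u hu => by
    have := mem_children.1 hu
    simp [f, this.1, this.2]
  have f2 : ∀ u (hu : u ≠ c ∧ par u ≠ c), f u = (e₂ ⟨u, hu⟩).1 := fun u hu => by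
    simp [f, hu.1, hu.2]
  have hcases : ∀ u, u = c ∨ u ∈ children c par c ∨ (u ≠ c ∧ par u ≠ c) := fun u => by
    rw [mem_children]; tauto
  have fne : ∀ u, u ≠ c → f u ≠ c' := fun u hu => by
    rcases hcases u with h1 | h1 | h1
    · exact absurd h1 hu
    · rw [f1 u h1]; exact (mem_children.1 (e₁ _).2).1
    · rw [f2 u h1]; exact (e₂ _).2.1
  have fpar : ∀ u, u ≠ c → par' (f u) = f (par u) := fun u hu => by
    rcases hcases u with h1 | h1 | h1
    · exact absurd h1 hu
    · rw [f1 u h1, (mem_children.1 h1).2, fc]; exact (mem_children.1 (e₁ _).2).2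
    · rw [f2 u h1, f1 _ (h.par_mem_children h2 h1.1 h1.2)]
      exact congrArg Subtype.val (he₂ ⟨u, h1⟩)
  have finj : Function.Injective f := by
    intro u v huv
    by_cases hu : u = c
    · by_contra hne
      exact fne v (fun e => hne (hu.trans e.symm)) (by rw [← huv, hu, fc])
    by_cases hv : v = c
    · exact absurd (by rw [huv, hv, fc]) (fne u hu)
    have hpp : par u = c ↔ par v = c := by
      have e1 := fpar u hu
      have e2 := fpar v hv
      rw [huv, e2] at e1
      constructor
      · intro hp; by_contra hq; exact fne _ hq (by rw [e1, hp, fc])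
      · intro hp; by_contra hq; exact fne _ hq (by rw [← e1, hp, fc])
    by_cases hp : par u = c
    · rw [f1 u (mem_children.2 ⟨hu, hp⟩), f1 v (mem_children.2 ⟨hv, hpp.1 hp⟩)] at huv
      exact congrArg Subtype.val (e₁.injective (Subtype.ext huv))
    · rw [f2 u ⟨hu, hp⟩, f2 v ⟨hv, fun e => hp (hpp.2 e)⟩] at huv
      exact congrArg Subtype.val (e₂.injective (Subtype.ext huv))
  have fbij : Function.Bijective f := (Fintype.bijective_iff_injective_and_card f).2 ⟨finj, hcard⟩
  refine ⟨⟨Equiv.ofBijective f fbij, fun {u v} => ?_⟩⟩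
  have hne : ∀ u, f u ≠ c' ↔ u ≠ c := fun u => ⟨fun h1 e => h1 (by rw [e, fc]), fne u⟩
  have hpe : ∀ u v, (u ≠ c ∧ par' (f u) = f v) ↔ (u ≠ c ∧ par u = v) := fun u v => by
    constructor
    · rintro ⟨h1, h3⟩; exact ⟨h1, finj ((fpar u h1).symm.trans h3)⟩
    · rintro ⟨h1, rfl⟩; exact ⟨h1, fpar u h1⟩
  change H.Adj (f u) (f v) ↔ G.Adj u v
  rw [h.adj_iff, h'.adj_iff, hne, hne, hpe, hpe]

end DepthTwoIso

/-! ### The star. -/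

section Star

lemma adj_iff_of_universal {V : Type*} {G : SimpleGraph V} (hG : G.IsTree) {c : V}
    (hc : ∀ v, c ≠ v → G.Adj c v) (x y : V) :
    G.Adj x y ↔ x ≠ y ∧ (x = c ∨ y = c) := by
  constructor
  · intro hxy
    refine ⟨hxy.ne, ?_⟩
    by_contra! hne
    apply hG.dist_ne_of_adj c hxy
    rw [dist_eq_one_iff_adj.2 (hc x hne.1.symm), dist_eq_one_iff_adj.2 (hc y hne.2.symm)]
  · rintro ⟨hne, rfl | rfl⟩
    · exact hc y hne
    · exact (hc x hne.symm).symm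

variable {V : Type*} [Fintype V] {G : SimpleGraph V}

lemma nonempty_iso_star (hG : G.IsTree) {n : ℕ} [NeZero n] (hn : Fintype.card V = n) {c : V}
    (hc : ∀ v, c ≠ v → G.Adj c v) : Nonempty (G ≃g star n) := by
  classical
  let e₀ : V ≃ Fin n := Fintype.equivFinOfCardEq hn
  let e : V ≃ Fin n := e₀.trans (Equiv.swap (e₀ c) 0)
  have hec : ∀ x, e x = 0 ↔ x = c := fun x => by
    rw [← e.injective.eq_iff (b := c)]
    simp [e]
  refine ⟨⟨e, fun {x y} => ?_⟩⟩
  rw [adj_iff_of_universal hG hc, star, starGraph_adj, hec, hec, e.injective.ne_iff]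

lemma twelve_augECI_of_universal (hG : G.IsTree) {m : ℕ} (hm : 2 ≤ m)
    (hV : Fintype.card V = m + 1) {c : V} (hc : ∀ v, c ≠ v → G.Adj c v) :
    12 * augECI G = ((12 + 6 * m ^ 2 : ℕ) : ℝ) := by
  classical
  obtain ⟨par, h⟩ := exists_isRooted hG c
  have hcon := hG.connected
  have h1 : ∀ v, v ≠ c → G.dist c v = 1 := fun v hv => dist_eq_one_iff_adj.2 (hc v hv.symm)
  have h2 : ∀ v, G.dist c v ≤ 2 := fun v => by
    by_cases hv : v = c
    · simp [hv]
    · rw [h1 v hv]; omega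
  have hN : children c par c = univ.erase c := by
    ext v
    simp only [mem_children, mem_erase, mem_univ, and_true, and_iff_left_iff_imp]
    intro hv
    have := h.dep_par v hv
    rw [h1 v hv] at this
    exact (hcon.dist_eq_zero_iff.1 (show G.dist c (par v) = 0 by omega)).symm
  have hcard : (children c par c).card = m := by
    rw [hN, card_erase_of_mem (mem_univ c), card_univ, hV]; rfl
  have hleaf : ∀ v ∈ children c par c, children c par v = ∅ := fun v hv => by
    rw [eq_empty_iff_forall_notMem]
    intro w hw
    have hd := h.dist_grandchild hv hw
    rw [h1 w (mem_children.1 hw).1] at hd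
    omega
  have hecc : ∀ v ∈ children c par c, ecc G v = 2 := fun v hv => by
    refine le_antisymm (ecc_le hcon fun w => ?_) ?_
    · have a1 := h.dist_le_add v w
      rw [h.dist_child hv] at a1
      have : G.dist c w ≤ 1 := by
        by_cases hw : w = c
        · simp [hw]
        · rw [h1 w hw]
      omega
    · obtain ⟨w, hw, hwv⟩ := exists_mem_ne (s := children c par c) (by omega) v
      exact (h.two_le_dist_children hv hw hwv.symm).trans (dist_le_ecc hcon _ _)
  have heccc : ecc G c = 1 := by
    refine le_antisymm (ecc_le hcon fun w => ?_) ?_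
    · by_cases hw : w = c
      · simp [hw]
      · rw [h1 w hw]
    · obtain ⟨w, hw⟩ : (children c par c).Nonempty := card_pos.1 (by omega)
      rw [← h.dist_child hw]
      exact dist_le_ecc hcon _ _
  rw [h.augECI_eq h2, heccc, hcard,
    prod_eq_one fun v hv => by
      rw [h.degree_ne (mem_children.1 hv).1, hleaf v hv, card_empty, zero_add],
    sum_eq_zero (f := fun v => ∑ u ∈ children c par v, (G.degree v : ℝ) / ecc G u)
      (fun v hv => by rw [hleaf v hv, sum_empty]),
    sum_congr rfl (g := fun _ => (m : ℝ) / 2) fun v hv => by rw [hecc v hv]; norm_num,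
    sum_const, hcard, nsmul_eq_mul]
  push_cast
  ring

end Star

/-! ### The structure of the balanced tree. -/

section Balanced

variable {V : Type*} [Fintype V] {G : SimpleGraph V} {c : V} {par : V → V}

lemma IsRooted.eq_of_mem_center (h : IsRooted G c par (G.dist c)) (h2 : ∀ v, G.dist c v ≤ 2)
    (hb : TwoBranches c par) {u : V} (hu : u ∈ G.center) : u = c := by
  have hle : ecc G u ≤ ecc G c := by
    have h1 : G.eccent u ≤ G.eccent c := by
      rw [(G.mem_center_iff u).1 hu]; exact radius_le_eccent
    rw [← coe_ecc h.connected, ← coe_ecc h.connected] at h1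
    exact_mod_cast h1
  rw [h.ecc_root h2 hb] at hle
  rcases h.trichotomy h2 u with h1 | h1 | ⟨v, hv, h1⟩
  · exact h1
  · rw [h.ecc_child h2 hb h1] at hle; omega
  · rw [h.ecc_grandchild h2 hb hv h1] at hle; omega

lemma IsRooted.diam_eq_four (h : IsRooted G c par (G.dist c)) (h2 : ∀ v, G.dist c v ≤ 2)
    (hb : TwoBranches c par) : G.diam = 4 := by
  have : Nonempty V := ⟨c⟩
  apply le_antisymm
  · obtain ⟨u, v, huv⟩ := G.exists_dist_eq_diam
    have := h.dist_le_add u v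
    have := h2 u
    have := h2 v
    omega
  · obtain ⟨a, ha, b, hbN, hab, ⟨u, hu⟩, ⟨w, hw⟩⟩ := hb
    exact (h.four_le_dist h2 ha hbN hab hu hw).trans
      (dist_le_diam (connected_iff_ediam_ne_top.1 h.connected))

/-- The structure of `TB_{n,k}` for `k = ⌈(n - 1) / 3⌉`. -/
lemma IsTB.exists_rooted {m : ℕ} (hm : 15 ≤ m) (hB : IsTB (m + 1) ((m + 2) / 3) G) :
    ∃ c par, IsRooted G c par (G.dist c) ∧ (∀ v, G.dist c v ≤ 2) ∧ TwoBranches c par ∧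
      degrees G (children c par c) = balancedParts m := by
  classical
  obtain ⟨hcard, ⟨hT, hdiam, hbal⟩, hk⟩ := hB
  have hG := hT.connected
  have := hG.nonempty
  have hfin := connected_iff_ediam_ne_top.1 hG
  have h4 : ∀ u v, G.dist u v ≤ 4 := fun u v => hdiam ▸ dist_le_diam hfin
  obtain ⟨c, hc⟩ := G.center_nonempty
  have hmin : ∀ u, ecc G c ≤ ecc G u := fun u => by
    have h1 : G.eccent c ≤ G.eccent u := by
      rw [(G.mem_center_iff c).1 hc]; exact radius_le_eccent
    rw [← coe_ecc hG, ← coe_ecc hG] at h1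
    exact_mod_cast h1
  have hc2 := ecc_le_two_of_center hT h4 hmin
  have h2 : ∀ v, G.dist c v ≤ 2 := fun v => (dist_le_ecc hG c v).trans hc2
  obtain ⟨par, h⟩ := exists_isRooted hT c
  refine ⟨c, par, h, h2, ?_, ?_⟩
  · obtain ⟨x, y, hxy⟩ := G.exists_dist_eq_diam
    rw [hdiam] at hxy
    have hsum := h.dist_le_add x y
    have hx2 := h2 x
    have hy2 := h2 y
    have hgc : ∀ z, G.dist c z = 2 → z ∈ children c par (par z) ∧ par z ∈ children c par c := by
      intro z hz
      rcases h.trichotomy h2 z with h1 | h1 | ⟨v, hv, h1⟩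
      · simp [h1] at hz
      · rw [h.dist_child h1] at hz; omega
      · rw [(mem_children.1 h1).2]; exact ⟨h1, hv⟩
    obtain ⟨hx, hpx⟩ := hgc x (by omega)
    obtain ⟨hy, hpy⟩ := hgc y (by omega)
    -- Vertices at distance four both have depth two; a common parent would put them within distance
    -- two.
    refine ⟨par x, hpx, par y, hpy, fun e => ?_, ⟨x, hx⟩, ⟨y, hy⟩⟩
    have ax : G.dist x (par x) = 1 := dist_eq_one_iff_adj.2
      ((h.adj_iff _ _).2 (Or.inl ⟨(mem_children.1 hx).1, rfl⟩))
    have ay : G.dist (par y) y = 1 := dist_eq_one_iff_adj.2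
      ((h.adj_iff _ _).2 (Or.inr ⟨(mem_children.1 hy).1, rfl⟩))
    have := hG.dist_triangle (u := x) (v := par x) (w := y)
    rw [e] at ax this
    omega
  · refine eq_balancedParts_of_balanced hm ?_ ?_ ?_
    · have := h.sum_degrees_children h2; omega
    · rw [card_degrees, ← hk c hc, ← card_neighborFinset_eq_degree, h.neighborFinset_root]
    · intro a ha b hb
      obtain ⟨v, hv, rfl⟩ := mem_degrees.1 ha
      obtain ⟨w, hw, rfl⟩ := mem_degrees.1 hb
      exact hbal c hc v w ((h.adj_iff _ _).2 (Or.inr (mem_children.1 hv)))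
        ((h.adj_iff _ _).2 (Or.inr (mem_children.1 hw)))

end Balanced

/-! ### Construction of the balanced tree. -/

section Existence

/-- The parent function on `0, …, m` sending `1, …, k` to `0`, and each `v > k` to the vertex of
`1, …, k` congruent to it modulo `k`. -/
def balancedParent (m k : ℕ) (v : Fin (m + 1)) : Fin (m + 1) :=
  if v.1 ≤ k then 0 else Fin.ofNat (m + 1) ((v.1 - 1) % k + 1)

/-- The depth of a vertex for `balancedParent`. -/
def balancedDepth (m k : ℕ) (v : Fin (m + 1)) : ℕ :=
  if v.1 = 0 then 0 else if v.1 ≤ k then 1 else 2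

/-- The tree with parent function `balancedParent`. -/
def balancedTree (m k : ℕ) : SimpleGraph (Fin (m + 1)) :=
  SimpleGraph.fromRel fun u v => u ≠ 0 ∧ balancedParent m k u = v

variable {m k : ℕ}

lemma balancedParent_val (hk : 0 < k) {v : Fin (m + 1)} (hv : k < v.1) :
    (balancedParent m k v).1 = (v.1 - 1) % k + 1 := by
  rw [balancedParent, if_neg (by omega)]
  have := Nat.mod_lt (v.1 - 1) hk
  exact Nat.mod_eq_of_lt (by omega)

lemma balancedTree_isRooted (hk : 0 < k) :
    IsRooted (balancedTree m k) 0 (balancedParent m k) (balancedDepth m k) := by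
  have hdep : ∀ u : Fin (m + 1), u ≠ 0 →
      balancedDepth m k (balancedParent m k u) + 1 = balancedDepth m k u := fun u hu => by
    have hu0 : u.1 ≠ 0 := fun e => hu (Fin.ext e)
    by_cases huk : u.1 ≤ k
    · simp [balancedDepth, balancedParent, huk, hu0]
    · have h1 := balancedParent_val hk (v := u) (by omega)
      have h2 := Nat.mod_lt (u.1 - 1) hk
      rw [balancedDepth, balancedDepth, h1]
      simp [hu0, huk]
      omega
  refine ⟨by simp [balancedDepth], hdep, fun u v => ?_⟩
  rw [balancedTree, SimpleGraph.fromRel_adj]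
  refine ⟨fun h => h.2, fun h => ⟨?_, h⟩⟩
  rintro rfl
  have h' : u ≠ 0 ∧ balancedParent m k u = u := by tauto
  have := hdep u h'.1
  rw [h'.2] at this
  omega

lemma balancedTree_children_zero (hk : 0 < k) (v : Fin (m + 1)) :
    v ∈ children 0 (balancedParent m k) 0 ↔ 1 ≤ v.1 ∧ v.1 ≤ k := by
  rw [mem_children]
  constructor
  · rintro ⟨h1, h2⟩
    refine ⟨Nat.pos_of_ne_zero fun e => h1 (Fin.ext e), ?_⟩
    by_contra! h3
    have := balancedParent_val hk h3
    rw [h2] at this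
    simp at this
  · rintro ⟨h1, h2⟩
    exact ⟨fun e => by simp [e] at h1, by simp [balancedParent, h2]⟩

lemma balancedTree_card_children_zero (hk : 0 < k) (hkm : k ≤ m) :
    (children 0 (balancedParent m k) 0).card = k := by
  rw [← card_map Fin.valEmbedding]
  have : (children 0 (balancedParent m k) 0).map Fin.valEmbedding = Icc 1 k := by
    ext x
    simp only [mem_map, balancedTree_children_zero hk, Fin.valEmbedding_apply, mem_Icc]
    constructor
    · rintro ⟨v, hv, rfl⟩; exact hv
    · intro hx; exact ⟨⟨x, by omega⟩, hx, rfl⟩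
  rw [this, Nat.card_Icc]; rfl

/-- The only possible children of $v$ are $v+k$ and $v+2k$. The first exists because $2k\le m$, and
$m\le 3k$ excludes any further one. -/
lemma balancedTree_children_bounds (hk : 0 < k) (hkm : 2 * k ≤ m) (hm : m ≤ 3 * k)
    {v : Fin (m + 1)} (hv : v ∈ children 0 (balancedParent m k) 0) :
    (children 0 (balancedParent m k) v).Nonempty ∧
      (children 0 (balancedParent m k) v).card ≤ 2 := by
  obtain ⟨h1, h2⟩ := (balancedTree_children_zero hk v).1 hv
  constructor
  · refine ⟨⟨v.1 + k, by omega⟩, mem_children.2 ⟨fun e => ?_, Fin.ext ?_⟩⟩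
    · have := congrArg Fin.val e
      simp at this
      omega
    · rw [balancedParent_val hk (v := ⟨v.1 + k, by omega⟩) (show k < v.1 + k by omega)]
      simp only
      rw [show v.1 + k - 1 = v.1 - 1 + k by omega, Nat.add_mod_right,
        Nat.mod_eq_of_lt (by omega)]
      omega
  · rw [← card_map Fin.valEmbedding]
    refine (card_le_card (t := {v.1 + k, v.1 + 2 * k}) fun x hx => ?_).trans card_le_two
    obtain ⟨u, hu, rfl⟩ := mem_map.1 hx
    obtain ⟨hu0, hup⟩ := mem_children.1 hu
    have huk : k < u.1 := by
      by_contra! hle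
      rw [balancedParent, if_pos hle] at hup
      rw [← hup] at h1
      simp at h1
    have hval := balancedParent_val hk huk
    rw [hup] at hval
    have hdm := Nat.div_add_mod (u.1 - 1) k
    have hlt : (u.1 - 1) / k < 3 := by
      rw [Nat.div_lt_iff_lt_mul hk]; omega
    have hpos : 0 < (u.1 - 1) / k := Nat.div_pos (by omega) hk
    simp only [Fin.valEmbedding_apply, mem_insert, mem_singleton]
    obtain hq | hq : (u.1 - 1) / k = 1 ∨ (u.1 - 1) / k = 2 := by omega
    · rw [hq] at hdm; left; omega
    · rw [hq] at hdm; right; omega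

theorem balancedTree_isTB (hm : 15 ≤ m) :
    IsTB (m + 1) ((m + 2) / 3) (balancedTree m ((m + 2) / 3)) := by
  classical
  obtain ⟨k, hkdef⟩ : ∃ k, (m + 2) / 3 = k := ⟨_, rfl⟩
  rw [hkdef]
  have hk : 0 < k := by omega
  have hkm : k ≤ m := by omega
  have h := balancedTree_isRooted (m := m) hk
  have h2 : ∀ v, (balancedTree m k).dist 0 v ≤ 2 := fun v => by
    rw [h.dist_eq, balancedDepth]
    split_ifs <;> omega
  have hT := h.isTree
  rw [← h.dist_eq] at h
  have hch := fun v hv => balancedTree_children_bounds (m := m) hk (by omega) (by omega) (v := v) hv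
  have hb : TwoBranches (0 : Fin (m + 1)) (balancedParent m k) := by
    have h1 : (⟨1, by omega⟩ : Fin (m + 1)) ∈ children 0 (balancedParent m k) 0 :=
      (balancedTree_children_zero hk _).2 (by simp; omega)
    have h3 : (⟨2, by omega⟩ : Fin (m + 1)) ∈ children 0 (balancedParent m k) 0 :=
      (balancedTree_children_zero hk _).2 (by simp; omega)
    exact ⟨_, h1, _, h3, by simp, (hch _ h1).1, (hch _ h3).1⟩
  refine ⟨by simp, ⟨hT, h.diam_eq_four h2 hb, ?_⟩, ?_⟩
  · intro u hu v w hv hw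
    obtain rfl := h.eq_of_mem_center h2 hb hu
    rw [← mem_neighborFinset, h.neighborFinset_root] at hv hw
    rw [h.degree_ne (mem_children.1 hv).1, h.degree_ne (mem_children.1 hw).1]
    have := (hch v hv).2
    have := card_pos.2 (hch w hw).1
    omega
  · intro u hu
    obtain rfl := h.eq_of_mem_center h2 hb hu
    rw [← card_neighborFinset_eq_degree, h.neighborFinset_root,
      balancedTree_card_children_zero hk hkm]

end Existence

/-! ### Case analysis and conclusion. -/

section Main

variable {V : Type*} [Fintype V] {G : SimpleGraph V}

lemma ceil_sub_one_div_three (m : ℕ) : ⌈(((m + 1 : ℕ) : ℝ) - 1) / 3⌉₊ = (m + 2) / 3 := by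
  have hx : (((m + 1 : ℕ) : ℝ) - 1) / 3 = (m : ℝ) / 3 := by push_cast; ring
  rw [hx]
  apply le_antisymm
  · rw [Nat.ceil_le, div_le_iff₀ (by norm_num)]
    exact_mod_cast (show m ≤ (m + 2) / 3 * 3 by omega)
  · have h1 : (m : ℝ) / 3 ≤ ⌈(m : ℝ) / 3⌉₊ := Nat.le_ceil _
    rw [div_le_iff₀ (by norm_num)] at h1
    have h2 : m ≤ ⌈(m : ℝ) / 3⌉₊ * 3 := by exact_mod_cast h1
    omega

/-- A tree is a star, or a tree of diameter four, or has index below those of the star and of the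
balanced tree. -/
theorem tree_cases (hG : G.IsTree) {m : ℕ} (hV : Fintype.card V = m + 1) :
    (∃ c, ∀ v, c ≠ v → G.Adj c v) ∨
    (2 ≤ m ∧ ∃ c par, IsRooted G c par (G.dist c) ∧ (∀ v, G.dist c v ≤ 2) ∧ TwoBranches c par) ∨
    (2 ≤ m ∧ (m ≤ 14 → 12 * augECI G < ((12 + 6 * m ^ 2 : ℕ) : ℝ)) ∧
      (15 ≤ m → 12 * augECI G < (weight (balancedParts m) : ℝ))) := by
  by_cases h1 : ∃ c, ∀ v, c ≠ v → G.Adj c v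
  · exact Or.inl h1
  refine Or.inr ?_
  have hecc : ∀ u, 2 ≤ ecc G u := fun u => by
    by_contra! hlt
    refine h1 ⟨u, (eccent_le_one_iff u).1 ?_⟩
    rw [← coe_ecc hG.connected]
    exact_mod_cast (show ecc G u ≤ 1 by omega)
  -- The star formula needs $m\ge 2$; a tree without a universal vertex meets this automatically.
  have hm : 2 ≤ m := by
    obtain ⟨c⟩ := hG.connected.nonempty
    obtain ⟨w, hw⟩ := exists_dist_eq_ecc hG.connected c
    have hcw : c ≠ w := by rintro rfl; have := hecc c; simp at hw; omega
    obtain ⟨p, hp, hd⟩ := exists_parent hG.connected hcw.symm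
    have := hecc c
    have hpc : p ≠ c := by rintro rfl; simp at hd; omega
    classical
    have h3 : ({c, w, p} : Finset V).card = 3 := by
      rw [card_eq_three]; exact ⟨c, w, p, hcw, hpc.symm, hp.ne.symm, rfl⟩
    have := card_le_univ ({c, w, p} : Finset V)
    omega
  by_cases h3 : ∀ u, 3 ≤ ecc G u
  · refine Or.inr ⟨hm, ?_⟩
    have hle := twelve_augECI_le_of_three_le_ecc h3
    have hb := sum_neighborDegreeProd_bound hG (m := m) (by omega) hV
    exact ⟨fun h => hle.trans_lt (by exact_mod_cast hb.1 h),
      fun h => hle.trans_lt (by exact_mod_cast hb.2 h)⟩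
  push Not at h3
  obtain ⟨c, hc⟩ := h3
  have h2 : ∀ v, G.dist c v ≤ 2 := fun v => (dist_le_ecc hG.connected c v).trans (by omega)
  obtain ⟨par, h⟩ := exists_isRooted hG c
  by_cases hb : TwoBranches c par
  · exact Or.inl ⟨hm, c, par, h, h2, hb⟩
  · refine Or.inr ⟨hm, ?_⟩
    have hlt := h.twelve_augECI_lt_star h2 hecc hb hV
    exact ⟨fun _ => hlt, fun h15 => hlt.trans
      (by exact_mod_cast star_lt_weight_balancedParts h15)⟩

lemma augECI_lt_star {n : ℕ} [NeZero n] (hn : n ≤ 15) (hG : G.IsTree) (hV : Fintype.card V = n)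
    (hne : ¬ Nonempty (G ≃g star n)) : augECI G < augECI (star n) := by
  obtain ⟨m, rfl⟩ := Nat.exists_eq_succ_of_ne_zero (NeZero.ne n)
  have hstar : 2 ≤ m → 12 * augECI (star (m + 1)) = ((12 + 6 * m ^ 2 : ℕ) : ℝ) := fun hm =>
    twelve_augECI_of_universal (isTree_starGraph _) hm (by simp) (c := 0)
      fun v hv => starGraph_center_adj hv
  rcases tree_cases hG hV with ⟨c, hc⟩ | ⟨hm, c, par, h, h2, hb⟩ | ⟨hm, h14, -⟩
  · exact absurd (nonempty_iso_star hG hV hc) hne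
  · have hlt := (small_bounds (m := m) (by omega) h.one_le_degrees_children
      (by have := h.sum_degrees_children h2; omega)).2
    have : 12 * augECI G < 12 * augECI (star (m + 1)) := by
      rw [h.twelve_augECI h2 hb, hstar hm]; exact_mod_cast hlt
    linarith
  · have := h14 (by omega)
    rw [← hstar hm] at this
    linarith

lemma augECI_lt_balanced {m : ℕ} (hm : 15 ≤ m) {B : SimpleGraph (Fin (m + 1))}
    (hB : IsTB (m + 1) ((m + 2) / 3) B) (hG : G.IsTree) (hV : Fintype.card V = m + 1)
    (hne : ¬ Nonempty (G ≃g B)) : augECI G < augECI B := by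
  obtain ⟨c', par', h', h2', hb', hd'⟩ := hB.exists_rooted hm
  have hBv := h'.twelve_augECI h2' hb'
  rw [hd'] at hBv
  suffices 12 * augECI G < 12 * augECI B by linarith
  rw [hBv]
  rcases tree_cases hG hV with ⟨c, hc⟩ | ⟨-, c, par, h, h2, hb⟩ | ⟨-, -, h15⟩
  · rw [twelve_augECI_of_universal hG (by omega) hV hc]
    exact_mod_cast star_lt_weight_balancedParts hm
  · rw [h.twelve_augECI h2 hb]
    obtain ⟨hle, heq⟩ := weight_le_balancedParts hm h.one_le_degrees_children
      (by have := h.sum_degrees_children h2; omega)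
    refine Nat.cast_lt.2 (lt_of_le_of_ne hle fun e => hne ?_)
    exact nonempty_iso_of_degrees_eq h h2 h' h2' ((heq e).trans hd'.symm) (by simpa using hV)
  · exact h15 hm

end Main

end AugECI
end

theorem theorem3p8 (n : ℕ) [NeZero n] :
    (n ≤ 15 →
      ∀ {V : Type*} [Fintype V] (T : SimpleGraph V), T.IsTree → Fintype.card V = n →
        AugECI.augECI T ≤ AugECI.augECI (AugECI.star n) ∧
        (AugECI.augECI T = AugECI.augECI (AugECI.star n) ↔ Nonempty (T ≃g AugECI.star n))) ∧
    (16 ≤ n →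
      (∃ B : SimpleGraph (Fin n), AugECI.IsTB n ⌈((n : ℝ) - 1) / 3⌉₊ B) ∧
      ∀ B : SimpleGraph (Fin n), AugECI.IsTB n ⌈((n : ℝ) - 1) / 3⌉₊ B →
        ∀ {V : Type*} [Fintype V] (T : SimpleGraph V), T.IsTree → Fintype.card V = n →
          AugECI.augECI T ≤ AugECI.augECI B ∧
          (AugECI.augECI T = AugECI.augECI B ↔ Nonempty (T ≃g B))) := by
  refine ⟨fun hn V _ T hT hV => ?_, fun hn => ?_⟩
  · by_cases h : Nonempty (T ≃g AugECI.star n)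
    · have heq := AugECI.augECI_iso h.some
      exact ⟨heq.le, iff_of_true heq h⟩
    · have hlt := AugECI.augECI_lt_star hn hT hV h
      exact ⟨hlt.le, iff_of_false hlt.ne h⟩
  · obtain ⟨m, rfl⟩ := Nat.exists_eq_succ_of_ne_zero (NeZero.ne n)
    rw [AugECI.ceil_sub_one_div_three]
    -- Uniqueness is contained in the claim for an arbitrary `B`: two such trees bound each other,
    -- so their indices agree and they are isomorphic.
    refine ⟨⟨_, AugECI.balancedTree_isTB (by omega)⟩, fun B hB V _ T hT hV => ?_⟩
    by_cases h : Nonempty (T ≃g B)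
    · have heq := AugECI.augECI_iso h.some
      exact ⟨heq.le, iff_of_true heq h⟩
    · have hlt := AugECI.augECI_lt_balanced (by omega) hB hT hV h
      exact ⟨hlt.le, iff_of_false hlt.ne h⟩
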